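/- Let $G$ be a locally compact Hausdorff group, $N$ a closed normal subgroup, $\lambda_G$ and $\lambda_N$ left Haar measures on $G$ and $N$, and $\lambda_{G/N}$ the left Haar measure on $G/N$ normalized by Weil's formula $\int_{G/N}\int_N f(xs)\,d\lambda_N(s)\,d\lambda_{G/N}(xN)=\int_G f\,d\lambda_G$ for $f\in\mathcal C_c(G)$. Let $\xi\in\Gamma(G,N)$, i.e. $\xi:N\to\mathbb T$ is a continuous homomorphism with $\xi(x^{-1}sx)=\xi(s)$ for all $x\in G$, $s\in N$. Let $\mathcal C_\xi(G,N)$ be the space of continuous $\psi:G\to\mathbb C$ such that $q(\operatorname{supp}\psi)$ is compact in $G/N$, where $q:G\to G/N$ is the quotient map, and $\psi(xk)=\xi(k)\psi(x)$ for all $x\in G$, $k\in N$. Let $L^1_\xi(G,N)$ be its completion for the norm $\|\psi\|_{(1)}=\int_{G/N}|\psi(y)|\,d\lambda_{G/N}(yN)$; it is a Banach algebra under the continuous extension of the covariant convolution $\psi\natural\phi(x)=\int_{G/N}\psi(y)\phi(y^{-1}x)\,d\lambda_{G/N}(yN)$. Let $T_\xi:L^1(G)\to L^1_\xi(G,N)$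 be the continuous extension of the map $T_\xi:\mathcal C_c(G)\to\mathcal C_\xi(G,N)$, $T_\xi(f)(x)=\int_N f(xs)\overline{\xi(s)}\,d\lambda_N(s)$. A two-sided approximate identity of a Banach algebra $A$ is a net $(e_\alpha)$ in $A$ with $\lim_\alpha a e_\alpha=a=\lim_\alpha e_\alpha a$ for all $a\in A$; it is sequential if it is a sequence. **Theorem.** The Banach algebra $L^1_\xi(G,N)$ has a two-sided approximate identity; more precisely, there is a two-sided approximate identity $(f_\alpha)$ of the convolution algebra $L^1(G)$ such that $(T_\xi(f_\alpha))$ is a two-sided approximate identity of $L^1_\xi(G,N)$. If $G$ is second countable, then $(f_\alpha)$, and hence $(T_\xi(f_\alpha))$, can be chosen to be a sequence. -/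

import Mathlib

open MeasureTheory Filter Topology

open scoped CompactlySupported

universe u

set_option linter.unusedSectionVars false

noncomputable section

namespace CovariantAlgebra

section Auxiliary

open scoped Pointwise

/-! Auxiliary facts on functions that transform under the kernel of an open quotient
homomorphism `p : G → Q` by a scalar function `c`; `s` is any section of `p`.
They are used with `Q = G ⧸ N` and with `Q = G`. -/

/-- A continuous function `ψ` on `G`, supported in the preimage of a compact subset of `Q`, with
`ψ (x n) = ψ (n x) = c n * ψ x` for all `n` in the kernel of `p`. -/
structure Good {G Q 𝕜 : Type*} [Group G] [TopologicalSpace G] [Group Q] [TopologicalSpace Q]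
    [RCLike 𝕜] (p : G →* Q) (c : G → 𝕜) (ψ : G → 𝕜) : Prop where
  cont : Continuous ψ
  supp : ∃ K : Set Q, IsCompact K ∧ ∀ x, ψ x ≠ 0 → p x ∈ K
  right : ∀ x n, p n = 1 → ψ (x * n) = c n * ψ x
  left : ∀ x n, p n = 1 → ψ (n * x) = c n * ψ x

/-- The restriction of `c` to the kernel of `p` is unimodular, satisfies `c n * c n⁻¹ = 1` and is
invariant under conjugation. -/
structure GoodChar {G Q 𝕜 : Type*} [Group G] [Group Q] [RCLike 𝕜] (p : G →* Q)
    (c : G → 𝕜) : Prop where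
  inv : ∀ n, p n = 1 → c n * c n⁻¹ = 1
  norm : ∀ n, p n = 1 → ‖c n‖ = 1
  conj : ∀ x n, p n = 1 → c (x⁻¹ * n * x) = c n

/-- Convolution over the quotient, through a section. -/
def qconv {G Q 𝕜 : Type*} [Group G] [RCLike 𝕜] [MeasurableSpace Q] (ν : Measure Q) (s : Q → G)
    (ψ φ : G → 𝕜) (x : G) : 𝕜 :=
  ∫ q, ψ (s q) * φ ((s q)⁻¹ * x) ∂ν

theorem sec_eq {G Q E : Type*} [Group G] [Group Q] {p : G →* Q} {s : Q → G}
    (hs : ∀ q, p (s q) = q) {F : G → E}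
    (hF : ∀ y n, p n = 1 → F (y * n) = F y) (y : G) : F (s (p y)) = F y := by
  have h := hF y (y⁻¹ * s (p y)) (by simp [hs])
  simpa using h

variable {G Q 𝕜 : Type*} [Group G] [TopologicalSpace G] [IsTopologicalGroup G]
  [Group Q] [TopologicalSpace Q] [IsTopologicalGroup Q] [T2Space Q]
  [MeasurableSpace Q] [BorelSpace Q] [RCLike 𝕜]
  {ν : Measure Q} [ν.IsHaarMeasure] {p : G →* Q} {s : Q → G}
  {c : G → 𝕜} {ψ φ χ : G → 𝕜}

theorem continuous_sec (hp : IsOpenQuotientMap p) (hs : ∀ q, p (s q) = q)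
    {E : Type*} [TopologicalSpace E] {F : G → E} (hc : Continuous F)
    (hF : ∀ y n, p n = 1 → F (y * n) = F y) : Continuous fun q => F (s q) := by
  rw [← hp.continuous_comp_iff]
  convert hc using 1
  funext y
  exact sec_eq hs hF y

theorem continuous_sec_right (hp : IsOpenQuotientMap p) (hs : ∀ q, p (s q) = q)
    {E X : Type*} [TopologicalSpace E] [TopologicalSpace X] {F : X → G → E}
    (hc : Continuous fun z : X × G => F z.1 z.2)
    (hF : ∀ x y n, p n = 1 → F x (y * n) = F x y) :
    Continuous fun z : X × Q => F z.1 (s z.2) := by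
  rw [← (IsOpenQuotientMap.id.prodMap hp).continuous_comp_iff]
  convert hc using 1
  funext z
  exact sec_eq hs (hF z.1) z.2

theorem continuous_sec₂ (hp : IsOpenQuotientMap p) (hs : ∀ q, p (s q) = q)
    {E : Type*} [TopologicalSpace E] {F : G → G → E}
    (hc : Continuous fun z : G × G => F z.1 z.2)
    (hF₁ : ∀ x y n, p n = 1 → F (y * n) x = F y x)
    (hF₂ : ∀ x y n, p n = 1 → F x (y * n) = F x y) :
    Continuous fun z : Q × Q => F (s z.1) (s z.2) := by
  rw [← (hp.prodMap hp).continuous_comp_iff]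
  convert hc using 1
  funext z
  exact (sec_eq hs (hF₂ _) z.2).trans (sec_eq hs (F := fun y => F y z.2) (hF₁ z.2) z.1)

theorem Good.inv_right (hφ : Good p c φ) (x y n : G) (hn : p n = 1) :
    φ ((y * n)⁻¹ * x) = c n⁻¹ * φ (y⁻¹ * x) := by
  rw [mul_inv_rev, mul_assoc]
  exact hφ.left _ _ (by simp [hn])

theorem Good.invariant (hχ : GoodChar p c) (hψ : Good p c ψ) (hφ : Good p c φ) (x y n : G)
    (hn : p n = 1) : ψ (y * n) * φ ((y * n)⁻¹ * x) = ψ y * φ (y⁻¹ * x) := by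
  rw [hφ.inv_right x y n hn, hψ.right y n hn]
  linear_combination ψ y * φ (y⁻¹ * x) * hχ.inv n hn

/-- The value of the integrand of the convolution does not depend on the representative. -/
theorem Good.integrand_eq (hχ : GoodChar p c) (hs : ∀ q, p (s q) = q) (hψ : Good p c ψ)
    (hφ : Good p c φ) (x y : G) :
    ψ (s (p y)) * φ ((s (p y))⁻¹ * x) = ψ y * φ (y⁻¹ * x) :=
  sec_eq hs (F := fun y => ψ y * φ (y⁻¹ * x)) (fun y n hn => hψ.invariant hχ hφ x y n hn) y

theorem Good.norm_right (hχ : GoodChar p c) (hψ : Good p c ψ) (y n : G) (hn : p n = 1) :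
    ‖ψ (y * n)‖ = ‖ψ y‖ := by
  rw [hψ.right y n hn, norm_mul, hχ.norm n hn, one_mul]

theorem goodChar_one : GoodChar p (fun _ => (1 : 𝕜)) :=
  ⟨by simp, by simp, by simp⟩

theorem Good.norm (hχ : GoodChar p c) (hψ : Good p c ψ) :
    Good p (fun _ => (1 : ℝ)) (fun x => ‖ψ x‖) where
  cont := hψ.cont.norm
  supp := by
    obtain ⟨K, hK, h⟩ := hψ.supp
    exact ⟨K, hK, fun x hx => h x (by simpa using hx)⟩
  right x n hn := by simp [hψ.right x n hn, hχ.norm n hn]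
  left x n hn := by simp [hψ.left x n hn, hχ.norm n hn]

theorem Good.integrable_norm (hp : IsOpenQuotientMap p) (hs : ∀ q, p (s q) = q)
    (hχ : GoodChar p c) (hψ : Good p c ψ) : Integrable (fun q => ‖ψ (s q)‖) ν := by
  obtain ⟨K, hK, h⟩ := hψ.supp
  refine (continuous_sec hp hs (F := fun y => ‖ψ y‖) hψ.cont.norm
    (fun y n hn => hψ.norm_right hχ y n hn)).integrable_of_hasCompactSupport ?_
  refine HasCompactSupport.intro hK fun q hq => ?_
  by_contra h0
  exact hq (by simpa [hs] using h (s q) (by simpa using h0))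

theorem Good.continuous_integrand (hp : IsOpenQuotientMap p) (hs : ∀ q, p (s q) = q)
    (hχ : GoodChar p c) (hψ : Good p c ψ) (hφ : Good p c φ) :
    Continuous fun z : G × Q => ψ (s z.2) * φ ((s z.2)⁻¹ * z.1) := by
  have h1 := hψ.cont
  have h2 := hφ.cont
  exact continuous_sec_right hp hs (F := fun x y => ψ y * φ (y⁻¹ * x)) (by fun_prop)
    (fun x y n hn => hψ.invariant hχ hφ x y n hn)

theorem Good.integrable_integrand (hp : IsOpenQuotientMap p) (hs : ∀ q, p (s q) = q)
    (hχ : GoodChar p c) (hψ : Good p c ψ) (hφ : Good p c φ) (x : G) :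
    Integrable (fun q => ψ (s q) * φ ((s q)⁻¹ * x)) ν := by
  obtain ⟨K, hK, h⟩ := hψ.supp
  refine ((hψ.continuous_integrand hp hs hχ hφ).comp
    (Continuous.prodMk_right x)).integrable_of_hasCompactSupport ?_
  refine HasCompactSupport.intro hK fun q hq => ?_
  have : ψ (s q) = 0 := by
    by_contra h0
    exact hq (by simpa [hs] using h (s q) h0)
  simp [this]

theorem Good.qconv (hp : IsOpenQuotientMap p) (hs : ∀ q, p (s q) = q)
    (hχ : GoodChar p c) (hψ : Good p c ψ) (hφ : Good p c φ) : Good p c (qconv ν s ψ φ) where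
  cont := by
    obtain ⟨K, hK, h⟩ := hψ.supp
    rw [← continuousOn_univ]
    refine continuousOn_integral_of_compact_support hK
      (f := fun x q => ψ (s q) * φ ((s q)⁻¹ * x))
      (hψ.continuous_integrand hp hs hχ hφ).continuousOn fun x q _ hq => ?_
    have : ψ (s q) = 0 := by
      by_contra h0
      exact hq (by simpa [hs] using h (s q) h0)
    simp [this]
  supp := by
    obtain ⟨K, hK, h⟩ := hψ.supp
    obtain ⟨L, hL, h'⟩ := hφ.supp
    refine ⟨K * L, hK.mul hL, fun x hx => ?_⟩
    obtain ⟨q, hq⟩ : ∃ q, ψ (s q) * φ ((s q)⁻¹ * x) ≠ 0 := by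
      by_contra! h0
      exact hx (by simp [CovariantAlgebra.qconv, h0])
    refine ⟨p (s q), h _ (left_ne_zero_of_mul hq), p ((s q)⁻¹ * x),
      h' _ (right_ne_zero_of_mul hq), by simp⟩
  right x n hn := by
    simp only [CovariantAlgebra.qconv, ← integral_const_mul]
    congr 1
    funext q
    rw [← mul_assoc, hφ.right _ n hn]
    ring
  left x n hn := by
    simp only [CovariantAlgebra.qconv, ← integral_const_mul]
    congr 1
    funext q
    have : (s q)⁻¹ * (n * x) = ((s q)⁻¹ * n * s q) * ((s q)⁻¹ * x) := by group
    rw [this, hφ.left _ _ (by simp [hn]), hχ.conj _ _ hn]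
    ring

theorem Good.translate_integral (hs : ∀ q, p (s q) = q) {E : Type*} [NormedAddCommGroup E]
    [NormedSpace ℝ E] {F : G → E} (hF : ∀ y n, p n = 1 → F (y * n) = F y) (z : G) :
    ∫ q, F (z⁻¹ * s q) ∂ν = ∫ q, F (s q) ∂ν := by
  rw [← integral_mul_left_eq_self (μ := ν) (fun q => F (z⁻¹ * s q)) (p z)]
  congr 1
  funext q
  have := sec_eq hs (F := fun y => F (z⁻¹ * y))
    (fun y n hn => by rw [← mul_assoc]; exact hF _ n hn) (z * s q)
  simpa [hs] using this

theorem Good.swap (hp : IsOpenQuotientMap p) (hs : ∀ q, p (s q) = q)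
    (hχ : GoodChar p c) (hψ : Good p c ψ) (hφ : Good p c φ) {F : G → 𝕜}
    (hF : Continuous F) (hFc : ∀ y n, p n = 1 → F (y * n) = c n⁻¹ * F y) :
    ∫ q, (∫ r, ψ (s r) * φ ((s r)⁻¹ * s q) * F (s q) ∂ν) ∂ν =
      ∫ r, (∫ q, ψ (s r) * φ ((s r)⁻¹ * s q) * F (s q) ∂ν) ∂ν := by
  obtain ⟨K, hK, h⟩ := hψ.supp
  obtain ⟨L, hL, h'⟩ := hφ.supp
  have h1 := hψ.cont
  have h2 := hφ.cont
  refine integral_integral_swap_of_hasCompactSupport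
    (f := fun q r => ψ (s r) * φ ((s r)⁻¹ * s q) * F (s q)) ?_ ?_
  · refine continuous_sec₂ hp hs (F := fun y z => ψ z * φ (z⁻¹ * y) * F y) (by fun_prop) ?_ ?_
    · intro x y n hn
      rw [← mul_assoc, hφ.right _ n hn, hFc y n hn]
      linear_combination ψ x * φ (x⁻¹ * y) * F y * hχ.inv n hn
    · intro x y n hn
      rw [hψ.invariant hχ hφ x y n hn]
  · refine HasCompactSupport.intro ((hK.mul hL).prod hK) ?_
    rintro ⟨q, r⟩ hqr
    by_contra h0
    have h3 : ψ (s r) * φ ((s r)⁻¹ * s q) ≠ 0 := left_ne_zero_of_mul h0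
    have h4 := h _ (left_ne_zero_of_mul h3)
    refine hqr ⟨⟨p (s r), h4, p ((s r)⁻¹ * s q), h' _ (right_ne_zero_of_mul h3), ?_⟩, ?_⟩
    · simp [hs]
    · simpa [hs] using h4

theorem Good.assoc (hp : IsOpenQuotientMap p) (hs : ∀ q, p (s q) = q)
    (hc : GoodChar p c) (hψ : Good p c ψ) (hφ : Good p c φ) (hχ : Good p c χ) :
    CovariantAlgebra.qconv ν s (CovariantAlgebra.qconv ν s ψ φ) χ =
      CovariantAlgebra.qconv ν s ψ (CovariantAlgebra.qconv ν s φ χ) := by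
  funext x
  have h3 := hχ.cont
  calc
    _ = ∫ q, (∫ r, ψ (s r) * φ ((s r)⁻¹ * s q) * χ ((s q)⁻¹ * x) ∂ν) ∂ν := by
      simp only [CovariantAlgebra.qconv, integral_mul_const]
    _ = ∫ r, (∫ q, ψ (s r) * φ ((s r)⁻¹ * s q) * χ ((s q)⁻¹ * x) ∂ν) ∂ν :=
      hψ.swap hp hs hc hφ (F := fun y => χ (y⁻¹ * x)) (by fun_prop)
        (fun y n hn => hχ.inv_right x y n hn)
    _ = _ := by
      simp only [CovariantAlgebra.qconv, ← integral_const_mul]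
      congr 1
      funext r
      have := Good.translate_integral (ν := ν) hs
        (F := fun y => ψ (s r) * (φ y * χ (y⁻¹ * ((s r)⁻¹ * x))))
        (fun y n hn => by rw [hφ.invariant hc hχ _ y n hn]) (s r)
      rw [← this]
      congr 1
      funext q
      simp [mul_assoc]

theorem Good.norm_qconv_le (hp : IsOpenQuotientMap p) (hs : ∀ q, p (s q) = q)
    (hc : GoodChar p c) (hψ : Good p c ψ) (hφ : Good p c φ) :
    ∫ q, ‖CovariantAlgebra.qconv ν s ψ φ (s q)‖ ∂ν ≤
      (∫ q, ‖ψ (s q)‖ ∂ν) * ∫ q, ‖φ (s q)‖ ∂ν := by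
  have hψ' := hψ.norm hc
  have hφ' := hφ.norm hc
  have h1 : GoodChar p (fun _ => (1 : ℝ)) := goodChar_one
  calc
    _ ≤ ∫ q, CovariantAlgebra.qconv ν s (fun x => ‖ψ x‖) (fun x => ‖φ x‖) (s q) ∂ν := by
      refine integral_mono ((hψ.qconv hp hs hc hφ).integrable_norm hp hs hc) ?_ fun q => ?_
      · refine ((hψ'.qconv (ν := ν) hp hs h1 hφ').integrable_norm (ν := ν) hp hs h1).congr ?_
        filter_upwards with q
        refine Real.norm_of_nonneg (integral_nonneg fun r => ?_)
        dsimp only [Pi.zero_apply]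
        positivity
      · refine (norm_integral_le_integral_norm _).trans_eq ?_
        simp [CovariantAlgebra.qconv]
    _ = ∫ r, (∫ q, ‖ψ (s r)‖ * ‖φ ((s r)⁻¹ * s q)‖ ∂ν) ∂ν := by
      have := hψ'.swap (ν := ν) hp hs h1 hφ' (F := fun _ => (1 : ℝ)) (by fun_prop) (by simp)
      simpa [CovariantAlgebra.qconv] using this
    _ = _ := by
      rw [← integral_mul_const]
      congr 1
      funext r
      rw [integral_const_mul]
      congr 1
      exact Good.translate_integral (ν := ν) hs (F := fun y => ‖φ y‖)
        (fun y n hn => hφ.norm_right hc y n hn) (s r)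

end Auxiliary
section Extension

/-! Extension of a bounded bilinear product from a dense subspace. -/

variable {V E : Type*} [AddCommGroup V] [Module ℂ V] [NormedAddCommGroup E] [NormedSpace ℂ E]
  [CompleteSpace E]

/-- The extension, in the second variable, of `(u, v) ↦ e (B u v)`. -/
def extendRight (e : V →ₗ[ℂ] E) (B : V →ₗ[ℂ] V →ₗ[ℂ] V) (hd : DenseRange e)
    (hB : ∀ u v, ‖e (B u v)‖ ≤ ‖e u‖ * ‖e v‖) : V →ₗ[ℂ] (E →L[ℂ] E) where
  toFun u := (e ∘ₗ B u).extendOfNorm e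
  map_add' u u' := LinearMap.extendOfNorm_unique hd (‖e (u + u')‖) (hB (u + u')) _ (by
    ext v
    have h1 := LinearMap.extendOfNorm_eq (f := e ∘ₗ B u) hd ⟨_, hB u⟩ v
    have h2 := LinearMap.extendOfNorm_eq (f := e ∘ₗ B u') hd ⟨_, hB u'⟩ v
    simp_all)
  map_smul' a u := LinearMap.extendOfNorm_unique hd (‖e (a • u)‖) (hB (a • u)) _ (by
    ext v
    have h1 := LinearMap.extendOfNorm_eq (f := e ∘ₗ B u) hd ⟨_, hB u⟩ v
    simp_all)

/-- The extension to `E` of a bilinear product `B` on `V`, where `e : V → E` has dense range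
and `‖e (B u v)‖ ≤ ‖e u‖ * ‖e v‖`. -/
def extendBilin (e : V →ₗ[ℂ] E) (B : V →ₗ[ℂ] V →ₗ[ℂ] V) (hd : DenseRange e)
    (hB : ∀ u v, ‖e (B u v)‖ ≤ ‖e u‖ * ‖e v‖) : E →L[ℂ] E →L[ℂ] E :=
  (extendRight e B hd hB).extendOfNorm e

variable {e : V →ₗ[ℂ] E} {B : V →ₗ[ℂ] V →ₗ[ℂ] V} (hd : DenseRange e)
  (hB : ∀ u v, ‖e (B u v)‖ ≤ ‖e u‖ * ‖e v‖)

theorem norm_extendRight_le (u : V) : ‖extendRight e B hd hB u‖ ≤ 1 * ‖e u‖ := by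
  rw [one_mul]
  exact LinearMap.opNorm_extendOfNorm_le (f := e ∘ₗ B u) hd (norm_nonneg _) (hB u)

theorem extendBilin_apply (u v : V) : extendBilin e B hd hB (e u) (e v) = e (B u v) := by
  have h1 : extendBilin e B hd hB (e u) = extendRight e B hd hB u :=
    LinearMap.extendOfNorm_eq hd ⟨1, norm_extendRight_le hd hB⟩ u
  rw [h1]
  exact LinearMap.extendOfNorm_eq (f := e ∘ₗ B u) hd ⟨_, hB u⟩ v

theorem norm_extendBilin_le (x y : E) : ‖extendBilin e B hd hB x y‖ ≤ ‖x‖ * ‖y‖ := by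
  refine ((extendBilin e B hd hB x).le_opNorm y).trans ?_
  gcongr
  simpa [extendBilin] using LinearMap.norm_extendOfNorm_apply_le hd 1 (norm_extendRight_le hd hB) x

theorem extendBilin_assoc (hassoc : ∀ u v w, B (B u v) w = B u (B v w)) (x y z : E) :
    extendBilin e B hd hB (extendBilin e B hd hB x y) z =
      extendBilin e B hd hB x (extendBilin e B hd hB y z) := by
  refine hd.induction_on₃ (p := fun x y z => extendBilin e B hd hB (extendBilin e B hd hB x y) z =
      extendBilin e B hd hB x (extendBilin e B hd hB y z))
    (isClosed_eq (by fun_prop) (by fun_prop)) (fun u v w => ?_) x y z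
  simp only [extendBilin_apply, hassoc]

end Extension

section GroupAlgebra

/-! The group algebra `L¹(G)`: the space `Lp ℂ 1 μ`, for a left Haar measure `μ`, with the unique
continuous extension of the convolution product of `C_c(G)`. -/

variable {G : Type*} [Group G] [TopologicalSpace G] [IsTopologicalGroup G] [T2Space G]
  [MeasurableSpace G] [BorelSpace G]

theorem good_of_cc (f : C_c(G, ℂ)) : Good (MonoidHom.id G) (fun _ => (1 : ℂ)) f where
  cont := f.continuous_toFun
  supp := ⟨tsupport f, f.hasCompactSupport, fun x hx => subset_tsupport f hx⟩
  right x n hn := by simp_all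
  left x n hn := by simp_all

theorem isOpenQuotientMap_monoidHomId : IsOpenQuotientMap (MonoidHom.id G) := IsOpenQuotientMap.id

variable (μ : Measure G) [μ.IsHaarMeasure]

/-- The convolution `(f ∗ g)(x) = ∫ f(y) g(y⁻¹x) dμ(y)` of `f, g ∈ C_c(G)`. -/
def ccConv (f g : C_c(G, ℂ)) : C_c(G, ℂ) where
  toFun x := ∫ y, f y * g (y⁻¹ * x) ∂μ
  continuous_toFun := ((good_of_cc f).qconv (ν := μ) (s := id) isOpenQuotientMap_monoidHomId
    (fun _ => rfl) goodChar_one (good_of_cc g)).cont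
  hasCompactSupport' := by
    obtain ⟨K, hK, h⟩ := ((good_of_cc f).qconv (ν := μ) (s := id) isOpenQuotientMap_monoidHomId
      (fun _ => rfl) goodChar_one (good_of_cc g)).supp
    exact HasCompactSupport.intro hK fun x hx => by
      by_contra h0
      exact hx (h x h0)

theorem cc_integrable_conv (f g : C_c(G, ℂ)) (x : G) :
    Integrable (fun y => f y * g (y⁻¹ * x)) μ :=
  (good_of_cc f).integrable_integrand (ν := μ) (s := id) isOpenQuotientMap_monoidHomId
    (fun _ => rfl) goodChar_one (good_of_cc g) x

/-- Convolution on `C_c(G)` as a bilinear map. -/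
def ccConvBilin : C_c(G, ℂ) →ₗ[ℂ] C_c(G, ℂ) →ₗ[ℂ] C_c(G, ℂ) :=
  LinearMap.mk₂ ℂ (ccConv μ)
    (fun f f' g => by
      ext x
      refine Eq.trans (integral_congr_ae (.of_forall fun y => ?_))
        (integral_add (cc_integrable_conv μ f g x) (cc_integrable_conv μ f' g x))
      simp [add_mul])
    (fun a f g => by
      ext x
      refine Eq.trans (integral_congr_ae (.of_forall fun y => ?_))
        (integral_const_mul a (fun y => f y * g (y⁻¹ * x)))
      simp [mul_assoc])
    (fun f g g' => by
      ext x
      refine Eq.trans (integral_congr_ae (.of_forall fun y => ?_))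
        (integral_add (cc_integrable_conv μ f g x) (cc_integrable_conv μ f g' x))
      simp [mul_add])
    (fun a f g => by
      ext x
      refine Eq.trans (integral_congr_ae (.of_forall fun y => ?_))
        (integral_const_mul a (fun y => f y * g (y⁻¹ * x)))
      simp [mul_left_comm])

/-- The inclusion of `C_c(G)` in `L¹(G)`. -/
def ccToL1 : C_c(G, ℂ) →ₗ[ℂ] Lp ℂ 1 μ where
  toFun f := (f.continuous_toFun.memLp_of_hasCompactSupport f.hasCompactSupport).toLp f
  map_add' _ _ := rfl
  map_smul' _ _ := rfl

theorem norm_ccToL1 (f : C_c(G, ℂ)) : ‖ccToL1 μ f‖ = ∫ x, ‖f x‖ ∂μ := by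
  rw [L1.norm_eq_integral_norm]
  exact integral_congr_ae ((MemLp.coeFn_toLp
    (f.continuous_toFun.memLp_of_hasCompactSupport f.hasCompactSupport)).fun_comp norm)

theorem norm_ccToL1_conv_le (f g : C_c(G, ℂ)) :
    ‖ccToL1 μ (ccConvBilin μ f g)‖ ≤ ‖ccToL1 μ f‖ * ‖ccToL1 μ g‖ := by
  simp only [norm_ccToL1]
  exact (good_of_cc f).norm_qconv_le (ν := μ) (s := id) isOpenQuotientMap_monoidHomId
    (fun _ => rfl) goodChar_one (good_of_cc g)

theorem ccConvBilin_assoc (f g h : C_c(G, ℂ)) :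
    ccConvBilin μ (ccConvBilin μ f g) h = ccConvBilin μ f (ccConvBilin μ g h) :=
  DFunLike.coe_injective ((good_of_cc f).assoc (ν := μ) (s := id) isOpenQuotientMap_monoidHomId
    (fun _ => rfl) goodChar_one (good_of_cc g) (good_of_cc h))

variable [LocallyCompactSpace G] [μ.Regular]

theorem exists_cc_eLpNorm_sub_le {f : G → ℂ} (hf : MemLp f 1 μ) {ε : ENNReal} (hε : ε ≠ 0) :
    ∃ g : G → ℂ, eLpNorm (f - g) 1 μ ≤ ε ∧ Continuous g ∧ HasCompactSupport g := by
  refine hf.induction_dense (by simp) (fun g => Continuous g ∧ HasCompactSupport g)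
    ?_ ?_ ?_ hε
  · intro c t ht htμ ε hε
    obtain ⟨δ, hδ0, hδ⟩ := exists_Lp_half ℂ μ 1 hε
    obtain ⟨η, hη0, hη⟩ := exists_eLpNorm_indicator_le (μ := μ) (p := 1) (by simp) c hδ0.ne'
    have hη0' : (η : ENNReal) ≠ 0 := by simpa using hη0.ne'
    obtain ⟨K, hKt, hK, hKc, hKμ⟩ := ht.exists_isCompact_isClosed_sdiff_lt htμ.ne hη0'
    obtain ⟨V, hKV, hV, -, hVμ⟩ := hKc.measurableSet.exists_isOpen_sdiff_lt
      (hK.measure_lt_top (μ := μ)).ne hη0'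
    obtain ⟨g, hg1, hg0, hgs, hg⟩ := exists_continuous_one_zero_of_isCompact hK hV.isClosed_compl
      (Set.disjoint_compl_right_iff_subset.mpr hKV)
    have hcont : Continuous fun x => (g x : ℂ) * c := by fun_prop
    have hsupp : HasCompactSupport fun x => (g x : ℂ) * c := by
      refine HasCompactSupport.intro hgs fun x hx => ?_
      simp [image_eq_zero_of_notMem_tsupport hx]
    refine ⟨fun x => g x * c, ?_, hcont, hsupp⟩
    have hmK : AEStronglyMeasurable (K.indicator fun _ => c) μ :=
      aestronglyMeasurable_const.indicator hKc.measurableSet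
    have h1 : eLpNorm ((fun x => (g x : ℂ) * c) - K.indicator fun _ => c) 1 μ ≤ δ := by
      refine le_trans (eLpNorm_mono fun x => ?_) (hη (V \ K) hVμ.le)
      by_cases hxK : x ∈ K
      · simp [hxK, hg1 hxK]
      · by_cases hxV : x ∈ V
        · simp only [Pi.sub_apply, Set.indicator_of_notMem hxK, sub_zero, norm_mul,
            Set.indicator_of_mem (show x ∈ V \ K from ⟨hxV, hxK⟩), Complex.norm_real,
            Real.norm_of_nonneg (hg x).1]
          exact mul_le_of_le_one_left (norm_nonneg _) (hg x).2
        · simp [hxK, hxV, hg0 (show x ∈ Vᶜ from hxV)]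
    have h2 : eLpNorm ((K.indicator fun _ => c) - t.indicator fun _ => c) 1 μ ≤ δ := by
      rw [← eLpNorm_neg, neg_sub, ← Set.indicator_sdiff hKt]
      exact hη _ hKμ.le
    have h3 := hδ _ _ ((hcont.memLp_of_hasCompactSupport (p := 1) hsupp).aestronglyMeasurable.sub hmK)
      (hmK.sub (aestronglyMeasurable_const.indicator ht)) h1 h2
    simpa using h3.le
  · rintro f g ⟨hf, hf'⟩ ⟨hg, hg'⟩
    exact ⟨hf.add hg, hf'.add hg'⟩
  · rintro f ⟨hf, hf'⟩
    exact (hf.memLp_of_hasCompactSupport (p := 1) (μ := μ) hf').aestronglyMeasurable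

theorem denseRange_ccToL1 : DenseRange (ccToL1 μ) := by
  intro f
  rw [Metric.mem_closure_iff]
  intro ε hε
  obtain ⟨g, hfg, hgc, hg⟩ :=
    exists_cc_eLpNorm_sub_le μ (Lp.memLp f) (ε := ENNReal.ofReal (ε / 2)) (by simpa using hε)
  have hgm : MemLp g 1 μ := hgc.memLp_of_hasCompactSupport hg
  refine ⟨_, ⟨⟨⟨g, hgc⟩, hg⟩, rfl⟩, ?_⟩
  rw [dist_eq_norm, Lp.norm_def]
  have h1 : eLpNorm (⇑(f - ccToL1 μ ⟨⟨g, hgc⟩, hg⟩)) 1 μ ≤ ENNReal.ofReal (ε / 2) := by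
    refine le_trans (le_of_eq (eLpNorm_congr_ae ?_)) hfg
    filter_upwards [Lp.coeFn_sub f (ccToL1 μ ⟨⟨g, hgc⟩, hg⟩), MemLp.coeFn_toLp hgm] with x h1 h2
    rw [h1]
    exact congrArg (f x - ·) h2
  calc _ ≤ (ENNReal.ofReal (ε / 2)).toReal := ENNReal.toReal_mono (by simp) h1
    _ = ε / 2 := ENNReal.toReal_ofReal (by positivity)
    _ < ε := by linarith

/-- Convolution on `L¹(G)`: the continuous bilinear extension of convolution on `C_c(G)`. -/
def l1Conv : Lp ℂ 1 μ →L[ℂ] Lp ℂ 1 μ →L[ℂ] Lp ℂ 1 μ :=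
  extendBilin (ccToL1 μ) (ccConvBilin μ) (denseRange_ccToL1 μ) (norm_ccToL1_conv_le μ)

/-- The Banach algebra `L¹(G)`, with convolution as product. -/
instance instL1Ring : NonUnitalNormedRing (Lp ℂ 1 μ) :=
  { (inferInstance : NormedAddCommGroup (Lp ℂ 1 μ)) with
    mul := fun f g => l1Conv μ f g
    left_distrib := fun f g h => map_add (l1Conv μ f) g h
    right_distrib := fun f g h => by
      change l1Conv μ (f + g) h = _
      rw [map_add]
      rfl
    zero_mul := fun f => by
      change l1Conv μ 0 f = 0
      simp
    mul_zero := fun f => map_zero (l1Conv μ f)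
    mul_assoc := extendBilin_assoc _ _ (ccConvBilin_assoc μ)
    norm_mul_le := norm_extendBilin_le _ _ }

theorem ccToL1_mul (f g : C_c(G, ℂ)) : ccToL1 μ f * ccToL1 μ g = ccToL1 μ (ccConv μ f g) :=
  extendBilin_apply _ _ f g

instance : IsScalarTower ℂ (Lp ℂ 1 μ) (Lp ℂ 1 μ) :=
  ⟨fun a f g => by
    change l1Conv μ (a • f) g = a • l1Conv μ f g
    simp⟩

instance : SMulCommClass ℂ (Lp ℂ 1 μ) (Lp ℂ 1 μ) :=
  ⟨fun a f g => by
    change a • l1Conv μ f g = l1Conv μ f (a • g)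
    simp⟩

end GroupAlgebra

section CovariantFunctions

variable {G : Type*} [Group G] [TopologicalSpace G] [IsTopologicalGroup G]
  {N : Subgroup G}

/-- For a covariant function `ψ`, the set `q(supp ψ)` is compact in `G ⧸ N` if and only if `ψ`
vanishes outside the preimage of some compact subset of `G ⧸ N`. -/
theorem isCompact_image_tsupport_iff [N.Normal] [IsClosed (N : Set G)] {ξ : N →ₜ* Circle}
    {ψ : G → ℂ} (hψ : ∀ (x : G) (k : N), ψ (x * k) = (ξ k : ℂ) * ψ x) :
    IsCompact ((QuotientGroup.mk : G → G ⧸ N) '' tsupport ψ) ↔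
      ∃ K : Set (G ⧸ N), IsCompact K ∧ ∀ x, ψ x ≠ 0 → (QuotientGroup.mk x : G ⧸ N) ∈ K := by
  refine ⟨fun h => ⟨_, h, fun x hx => ⟨x, subset_tsupport ψ hx, rfl⟩⟩, ?_⟩
  rintro ⟨K, hK, h⟩
  have h1 : (QuotientGroup.mk : G → G ⧸ N) ⁻¹' ((QuotientGroup.mk : G → G ⧸ N) ''
      Function.support ψ) = Function.support ψ := by
    refine Set.Subset.antisymm ?_ (Set.subset_preimage_image _ _)
    rintro x ⟨y, hy, hxy⟩
    have hn : y⁻¹ * x ∈ N := QuotientGroup.eq.mp hxy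
    have := hψ y ⟨_, hn⟩
    simp only [mul_inv_cancel_left] at this
    simp_all
  have h2 : tsupport ψ = (QuotientGroup.mk : G → G ⧸ N) ⁻¹'
      closure ((QuotientGroup.mk : G → G ⧸ N) '' Function.support ψ) := by
    rw [QuotientGroup.isOpenMap_coe.preimage_closure_eq_closure_preimage
      QuotientGroup.continuous_mk, h1]
    rfl
  rw [h2, Set.image_preimage_eq _ QuotientGroup.mk_surjective]
  refine hK.of_isClosed_subset isClosed_closure (closure_minimal ?_ hK.isClosed)
  rintro _ ⟨x, hx, rfl⟩
  exact h x hx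

variable (N) in
/-- The set `Γ(G, N)` of `G`-invariant characters of `N`: continuous homomorphisms `ξ` from `N` to
the circle group with `ξ (x⁻¹ s x) = ξ s` for all `x : G` and `s : N`. -/
structure InvariantCharacter [N.Normal] where
  /-- The underlying character of `N`. -/
  toHom : N →ₜ* Circle
  invariant : ∀ (x : G) (s : N),
    toHom ⟨x⁻¹ * s * x, Subgroup.Normal.conj_mem' inferInstance _ s.2 x⟩ = toHom s

/-- The space `C_ξ(G, N)` of continuous functions `ψ : G → ℂ` such that `q(supp ψ)` is compact
in `G ⧸ N`, where `q : G → G ⧸ N` is the quotient map, and `ψ (x k) = ξ k * ψ x`. -/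
def covariantSubmodule [N.Normal] [IsClosed (N : Set G)] (ξ : N →ₜ* Circle) :
    Submodule ℂ (G → ℂ) where
  carrier := {ψ | Continuous ψ ∧ IsCompact ((QuotientGroup.mk : G → G ⧸ N) '' tsupport ψ) ∧
    ∀ (x : G) (k : N), ψ (x * k) = (ξ k : ℂ) * ψ x}
  zero_mem' := ⟨continuous_zero, by
    simp [tsupport], by simp⟩
  add_mem' := by
    rintro ψ φ ⟨h1, h2, h3⟩ ⟨h1', h2', h3'⟩
    have h : ∀ (x : G) (k : N), (ψ + φ) (x * k) = (ξ k : ℂ) * (ψ + φ) x := fun x k => by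
      simp [h3, h3', mul_add]
    refine ⟨h1.add h1', (isCompact_image_tsupport_iff h).mpr ?_, h⟩
    obtain ⟨K, hK, hψ⟩ := (isCompact_image_tsupport_iff h3).mp h2
    obtain ⟨L, hL, hφ⟩ := (isCompact_image_tsupport_iff h3').mp h2'
    refine ⟨K ∪ L, hK.union hL, fun x hx => ?_⟩
    by_cases h0 : ψ x = 0
    · exact Or.inr (hφ x (by simpa [h0] using hx))
    · exact Or.inl (hψ x h0)
  smul_mem' := by
    rintro a ψ ⟨h1, h2, h3⟩
    have h : ∀ (x : G) (k : N), (a • ψ) (x * k) = (ξ k : ℂ) * (a • ψ) x := fun x k => by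
      simp [h3, mul_left_comm]
    refine ⟨h1.const_smul a, (isCompact_image_tsupport_iff h).mpr ?_, h⟩
    obtain ⟨K, hK, hψ⟩ := (isCompact_image_tsupport_iff h3).mp h2
    exact ⟨K, hK, fun x hx => hψ x (right_ne_zero_of_mul (a := a) (by simpa using hx))⟩

/-- A character of `N`, extended to `G` by the value `1`. -/
def extChar (ξ : N →ₜ* Circle) (x : G) : ℂ :=
  open scoped Classical in if h : x ∈ N then (ξ ⟨x, h⟩ : ℂ) else 1

theorem extChar_of_mem (ξ : N →ₜ* Circle) (x : G) (h : x ∈ N) :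
    extChar ξ x = (ξ ⟨x, h⟩ : ℂ) := by
  simp [extChar, h]

variable [N.Normal]

theorem goodChar_extChar (ξ : InvariantCharacter N) :
    GoodChar (QuotientGroup.mk' N) (extChar ξ.toHom) where
  inv n hn := by
    have hn : n ∈ N := by simpa using hn
    rw [extChar_of_mem _ _ hn, extChar_of_mem _ _ (inv_mem hn), ← Circle.coe_mul, ← map_mul]
    have : (⟨n, hn⟩ * ⟨n⁻¹, inv_mem hn⟩ : N) = 1 := by ext; simp
    rw [this]
    simp
  norm n hn := by
    have hn : n ∈ N := by simpa using hn
    rw [extChar_of_mem _ _ hn, Circle.norm_coe]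
  conj x n hn := by
    have hn : n ∈ N := by simpa using hn
    rw [extChar_of_mem _ _ hn, extChar_of_mem _ _ (Subgroup.Normal.conj_mem' inferInstance _ hn x),
      ξ.invariant x ⟨n, hn⟩]

theorem mk_out (q : G ⧸ N) : QuotientGroup.mk' N q.out = q := QuotientGroup.out_eq' q

theorem isOpenQuotientMap_mk' : IsOpenQuotientMap (QuotientGroup.mk' N) :=
  QuotientGroup.isOpenQuotientMap_mk

variable [IsClosed (N : Set G)]

theorem good_of_mem (ξ : InvariantCharacter N) {ψ : G → ℂ} (h : ψ ∈ covariantSubmodule ξ.toHom) :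
    Good (QuotientGroup.mk' N) (extChar ξ.toHom) ψ := by
  have hr : ∀ x n, QuotientGroup.mk' N n = 1 → ψ (x * n) = extChar ξ.toHom n * ψ x := by
    intro x n hn
    have hn : n ∈ N := by simpa using hn
    rw [extChar_of_mem _ _ hn]
    exact h.2.2 x ⟨n, hn⟩
  refine ⟨h.1, (isCompact_image_tsupport_iff h.2.2).mp h.2.1, hr, fun x n hn => ?_⟩
  have h1 : n * x = x * (x⁻¹ * n * x) := by group
  rw [h1, hr x _ (by rw [map_mul, map_mul, hn]; simp), (goodChar_extChar ξ).conj x n hn]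

theorem mem_of_good {ξ : N →ₜ* Circle} {ψ : G → ℂ}
    (h : Good (QuotientGroup.mk' N) (extChar ξ) ψ) : ψ ∈ covariantSubmodule ξ := by
  have h1 : ∀ (x : G) (k : N), ψ (x * k) = (ξ k : ℂ) * ψ x := fun x k => by
    rw [h.right x k (by simp), extChar_of_mem _ _ k.2]
  exact ⟨h.cont, (isCompact_image_tsupport_iff h1).mpr h.supp, h1⟩

/-- The space `C_ξ(G, N)`, to be equipped with the norm `‖ψ‖ = ∫ |ψ(y)| dν(yN)`, where `ν` is a
left Haar measure on `G ⧸ N`. -/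
def CovariantFunction [MeasurableSpace (G ⧸ N)] (_ν : Measure (G ⧸ N))
    (ξ : InvariantCharacter N) : Type _ :=
  covariantSubmodule ξ.toHom

variable [MeasurableSpace (G ⧸ N)] (ν : Measure (G ⧸ N)) (ξ : InvariantCharacter N)

instance : AddCommGroup (CovariantFunction ν ξ) :=
  inferInstanceAs (AddCommGroup (covariantSubmodule ξ.toHom))

instance : Module ℂ (CovariantFunction ν ξ) :=
  inferInstanceAs (Module ℂ (covariantSubmodule ξ.toHom))

instance : CoeFun (CovariantFunction ν ξ) (fun _ => G → ℂ) := ⟨Subtype.val⟩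

variable {ν ξ} in
theorem CovariantFunction.good (ψ : CovariantFunction ν ξ) :
    Good (QuotientGroup.mk' N) (extChar ξ.toHom) ψ :=
  good_of_mem ξ ψ.2

variable [BorelSpace (G ⧸ N)] [ν.IsHaarMeasure]

/-- The norm `‖ψ‖ = ∫ |ψ(y)| dν(yN)`. As `|ψ|` is constant on the cosets of `N`, the choice of the
representative `q.out` of the coset `q` is irrelevant. -/
instance : Norm (CovariantFunction ν ξ) := ⟨fun ψ => ∫ q, ‖ψ q.out‖ ∂ν⟩

theorem CovariantFunction.norm_def (ψ : CovariantFunction ν ξ) : ‖ψ‖ = ∫ q, ‖ψ q.out‖ ∂ν := rfl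

theorem CovariantFunction.integrable (ψ : CovariantFunction ν ξ) :
    Integrable (fun q => ‖ψ q.out‖) ν :=
  ψ.good.integrable_norm isOpenQuotientMap_mk' mk_out (goodChar_extChar ξ)

theorem CovariantFunction.normedSpaceCore : NormedSpace.Core ℂ (CovariantFunction ν ξ) where
  norm_nonneg ψ := integral_nonneg fun q => norm_nonneg _
  norm_smul a ψ := by
    rw [norm_def, norm_def, ← integral_const_mul]
    exact integral_congr_ae (.of_forall fun q => norm_mul a _)
  norm_triangle ψ φ := by
    rw [norm_def, norm_def, norm_def, ← integral_add (integrable ν ξ ψ) (integrable ν ξ φ)]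
    exact integral_mono (integrable ν ξ _) ((integrable ν ξ ψ).add (integrable ν ξ φ))
      fun q => norm_add_le _ _
  norm_eq_zero_iff ψ := by
    refine ⟨fun h => ?_, fun h => ?_⟩
    · have hc : Continuous fun q : G ⧸ N => ‖ψ q.out‖ :=
        continuous_sec isOpenQuotientMap_mk' mk_out (F := fun y => ‖ψ y‖) ψ.good.cont.norm
          (fun y n hn => ψ.good.norm_right (goodChar_extChar ξ) y n hn)
      have h0 : (fun q : G ⧸ N => ‖ψ q.out‖) = 0 :=
        (hc.ae_eq_iff_eq ν continuous_zero).mp ((integral_eq_zero_iff_of_nonneg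
          (fun q => norm_nonneg _) (integrable ν ξ ψ)).mp h)
      refine Subtype.ext (funext fun y => ?_)
      have h1 := sec_eq mk_out (F := fun y => ‖ψ y‖)
        (fun y n hn => ψ.good.norm_right (goodChar_extChar ξ) y n hn) y
      have h2 := congrFun h0 (QuotientGroup.mk' N y)
      exact norm_eq_zero.mp (h1.symm.trans h2)
    · subst h
      exact (integral_congr_ae (.of_forall fun q => norm_zero)).trans (integral_zero _ _)

instance : NormedAddCommGroup (CovariantFunction ν ξ) :=
  NormedAddCommGroup.ofCore (CovariantFunction.normedSpaceCore ν ξ)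

instance : NormedSpace ℂ (CovariantFunction ν ξ) :=
  NormedSpace.ofCore (CovariantFunction.normedSpaceCore ν ξ)

/-- The covariant convolution `(ψ ♮ φ)(x) = ∫ ψ(y) φ(y⁻¹x) dν(yN)` on `C_ξ(G, N)`. The integrand
does not depend on the representative `y = q.out` of the coset `q`. -/
def covConv (ψ φ : CovariantFunction ν ξ) : CovariantFunction ν ξ :=
  ⟨fun x => ∫ q, ψ q.out * φ (q.out⁻¹ * x) ∂ν,
    mem_of_good (ψ.good.qconv isOpenQuotientMap_mk' mk_out (goodChar_extChar ξ) φ.good)⟩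

theorem covConv_integrand_eq (ψ φ : CovariantFunction ν ξ) (x y : G) :
    ψ (y : G ⧸ N).out * φ ((y : G ⧸ N).out⁻¹ * x) = ψ y * φ (y⁻¹ * x) :=
  ψ.good.integrand_eq (goodChar_extChar ξ) mk_out φ.good x y

theorem covConv_integrable (ψ φ : CovariantFunction ν ξ) (x : G) :
    Integrable (fun q : G ⧸ N => ψ q.out * φ (q.out⁻¹ * x)) ν :=
  ψ.good.integrable_integrand isOpenQuotientMap_mk' mk_out (goodChar_extChar ξ) φ.good x

/-- The covariant convolution on `C_ξ(G, N)` as a bilinear map. -/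
def covConvBilin :
    CovariantFunction ν ξ →ₗ[ℂ] CovariantFunction ν ξ →ₗ[ℂ] CovariantFunction ν ξ :=
  LinearMap.mk₂ ℂ (covConv ν ξ)
    (fun ψ ψ' φ => Subtype.ext <| funext fun x => by
      refine Eq.trans (integral_congr_ae (.of_forall fun y => ?_))
        (integral_add (covConv_integrable ν ξ ψ φ x) (covConv_integrable ν ξ ψ' φ x))
      exact add_mul _ _ _)
    (fun a ψ φ => Subtype.ext <| funext fun x => by
      refine Eq.trans (integral_congr_ae (.of_forall fun y => ?_))
        (integral_const_mul a (fun q : G ⧸ N => ψ q.out * φ (q.out⁻¹ * x)))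
      exact mul_assoc _ _ _)
    (fun ψ φ φ' => Subtype.ext <| funext fun x => by
      refine Eq.trans (integral_congr_ae (.of_forall fun y => ?_))
        (integral_add (covConv_integrable ν ξ ψ φ x) (covConv_integrable ν ξ ψ φ' x))
      exact mul_add _ _ _)
    (fun a ψ φ => Subtype.ext <| funext fun x => by
      refine Eq.trans (integral_congr_ae (.of_forall fun y => ?_))
        (integral_const_mul a (fun q : G ⧸ N => ψ q.out * φ (q.out⁻¹ * x)))
      exact mul_left_comm _ _ _)

/-- The Banach space `L¹_ξ(G, N)`: the completion of `C_ξ(G, N)`. -/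
abbrev CovariantL1 : Type _ := UniformSpace.Completion (CovariantFunction ν ξ)

/-- The inclusion of `C_ξ(G, N)` in `L¹_ξ(G, N)`. -/
def covToL1 : CovariantFunction ν ξ →ₗ[ℂ] CovariantL1 ν ξ :=
  (UniformSpace.Completion.toComplₗᵢ (𝕜 := ℂ)).toLinearMap

theorem denseRange_covToL1 : DenseRange (covToL1 ν ξ) := UniformSpace.Completion.denseRange_coe

theorem norm_covToL1 (ψ : CovariantFunction ν ξ) : ‖covToL1 ν ξ ψ‖ = ‖ψ‖ :=
  UniformSpace.Completion.norm_coe ψ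

theorem norm_covToL1_conv_le (ψ φ : CovariantFunction ν ξ) :
    ‖covToL1 ν ξ (covConvBilin ν ξ ψ φ)‖ ≤ ‖covToL1 ν ξ ψ‖ * ‖covToL1 ν ξ φ‖ := by
  rw [norm_covToL1, norm_covToL1, norm_covToL1]
  exact ψ.good.norm_qconv_le isOpenQuotientMap_mk' mk_out (goodChar_extChar ξ) φ.good

theorem covConvBilin_assoc (ψ φ χ : CovariantFunction ν ξ) :
    covConvBilin ν ξ (covConvBilin ν ξ ψ φ) χ = covConvBilin ν ξ ψ (covConvBilin ν ξ φ χ) :=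
  Subtype.ext
    (ψ.good.assoc isOpenQuotientMap_mk' mk_out (goodChar_extChar ξ) φ.good χ.good)

/-- The covariant convolution on `L¹_ξ(G, N)`: the continuous bilinear extension of the covariant
convolution on `C_ξ(G, N)`. -/
def covL1Conv : CovariantL1 ν ξ →L[ℂ] CovariantL1 ν ξ →L[ℂ] CovariantL1 ν ξ :=
  extendBilin (covToL1 ν ξ) (covConvBilin ν ξ) (denseRange_covToL1 ν ξ) (norm_covToL1_conv_le ν ξ)

/-- The Banach algebra `L¹_ξ(G, N)`, with the covariant convolution as product. -/
instance instCovariantL1Ring : NonUnitalNormedRing (CovariantL1 ν ξ) :=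
  { (inferInstance : NormedAddCommGroup (CovariantL1 ν ξ)) with
    mul := fun f g => covL1Conv ν ξ f g
    left_distrib := fun f g h => map_add (covL1Conv ν ξ f) g h
    right_distrib := fun f g h => by
      change covL1Conv ν ξ (f + g) h = _
      rw [map_add]
      rfl
    zero_mul := fun f => by
      change covL1Conv ν ξ 0 f = 0
      simp
    mul_zero := fun f => map_zero (covL1Conv ν ξ f)
    mul_assoc := extendBilin_assoc _ _ (covConvBilin_assoc ν ξ)
    norm_mul_le := norm_extendBilin_le _ _ }

theorem covToL1_mul (ψ φ : CovariantFunction ν ξ) :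
    covToL1 ν ξ ψ * covToL1 ν ξ φ = covToL1 ν ξ (covConv ν ξ ψ φ) :=
  extendBilin_apply _ _ ψ φ

instance : IsScalarTower ℂ (CovariantL1 ν ξ) (CovariantL1 ν ξ) :=
  ⟨fun a f g => by
    change covL1Conv ν ξ (a • f) g = a • covL1Conv ν ξ f g
    simp⟩

instance : SMulCommClass ℂ (CovariantL1 ν ξ) (CovariantL1 ν ξ) :=
  ⟨fun a f g => by
    change a • covL1Conv ν ξ f g = covL1Conv ν ξ f (a • g)
    simp⟩

end CovariantFunctions

section Transform

variable {G : Type*} [Group G] [TopologicalSpace G] [IsTopologicalGroup G]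
  [MeasurableSpace G] [BorelSpace G] {N : Subgroup G} [N.Normal] [IsClosed (N : Set G)]

theorem cc_restrict_compact (f : C_c(G, ℂ)) {W : Set G} (hW : IsCompact W) :
    IsCompact {s : N | ∃ w ∈ W, ∃ y ∈ tsupport f, (s : G) = w⁻¹ * y} := by
  have h : IsCompact ((fun z : G × G => z.1⁻¹ * z.2) '' (W ×ˢ tsupport f)) :=
    (hW.prod f.hasCompactSupport).image (by fun_prop)
  have h' := (show IsClosed (N : Set G) from inferInstance).isClosedEmbedding_subtypeVal
  have h2 : {s : N | ∃ w ∈ W, ∃ y ∈ tsupport f, (s : G) = w⁻¹ * y} =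
      (Subtype.val : N → G) ⁻¹' ((fun z : G × G => z.1⁻¹ * z.2) '' (W ×ˢ tsupport f)) := by
    refine Set.Subset.antisymm ?_ ?_
    · rintro s ⟨w, hw, y, hy, hs⟩
      exact ⟨(w, y), ⟨hw, hy⟩, hs.symm⟩
    · rintro s ⟨⟨w, y⟩, ⟨hw, hy⟩, hs⟩
      exact ⟨w, hw, y, hy, hs.symm⟩
  rw [h2]
  exact h'.isCompact_preimage h

theorem cc_restrict_support (f : C_c(G, ℂ)) (ξ : N →ₜ* Circle) {W : Set G} {x : G} (hx : x ∈ W)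
    (s : N) (hs : s ∉ {s : N | ∃ w ∈ W, ∃ y ∈ tsupport f, (s : G) = w⁻¹ * y}) :
    f (x * s) * starRingEnd ℂ (ξ s) = 0 := by
  have : f (x * s) = 0 := by
    by_contra h0
    exact hs ⟨x, hx, x * s, subset_tsupport f h0, by simp⟩
  simp [this]

theorem continuous_transform_integrand (f : C_c(G, ℂ)) (ξ : N →ₜ* Circle) :
    Continuous fun z : G × N => f (z.1 * z.2) * starRingEnd ℂ (ξ z.2) := by
  have h1 := f.continuous_toFun
  have h2 : Continuous fun s : N => (ξ s : ℂ) :=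
    continuous_subtype_val.comp ξ.continuous_toFun
  have h3 := Complex.continuous_conj
  exact (h1.comp (by fun_prop)).mul (h3.comp (h2.comp continuous_snd))

variable (lN : Measure N) [lN.IsHaarMeasure]

theorem transform_integrable (f : C_c(G, ℂ)) (ξ : N →ₜ* Circle) (x : G) :
    Integrable (fun s : N => f (x * s) * starRingEnd ℂ (ξ s)) lN := by
  refine ((continuous_transform_integrand f ξ).comp
    (Continuous.prodMk_right x)).integrable_of_hasCompactSupport ?_
  exact HasCompactSupport.intro (cc_restrict_compact f (isCompact_singleton (x := x)))
    fun s hs => cc_restrict_support f ξ (Set.mem_singleton x) s hs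

variable [LocallyCompactSpace G]

theorem transform_mem (f : C_c(G, ℂ)) (ξ : N →ₜ* Circle) :
    (fun x => ∫ s : N, f (x * s) * starRingEnd ℂ (ξ s) ∂lN) ∈ covariantSubmodule ξ := by
  have h : ∀ (x : G) (k : N), (∫ s : N, f (x * k * s) * starRingEnd ℂ (ξ s) ∂lN) =
      ξ k * ∫ s : N, f (x * s) * starRingEnd ℂ (ξ s) ∂lN := fun x k => by
    rw [← integral_mul_left_eq_self (fun s : N => f (x * s) * starRingEnd ℂ (ξ s)) k, ← integral_const_mul]
    refine integral_congr_ae (.of_forall fun s => ?_)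
    have : (ξ k : ℂ) * starRingEnd ℂ (ξ k) = 1 := by
      rw [Complex.mul_conj, Circle.normSq_coe, Complex.ofReal_one]
    simp only [Subgroup.coe_mul, map_mul, Circle.coe_mul, mul_assoc]
    linear_combination (-f (x * (k * s)) * starRingEnd ℂ (ξ s)) * this
  refine ⟨?_, (isCompact_image_tsupport_iff h).mpr ?_, h⟩
  · rw [continuous_iff_continuousAt]
    intro x
    obtain ⟨W, hW, hxW⟩ := exists_compact_mem_nhds x
    exact (continuousOn_integral_of_compact_support (cc_restrict_compact f hW)
      (f := fun x (s : N) => f (x * s) * starRingEnd ℂ (ξ s))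
      (continuous_transform_integrand f ξ).continuousOn
      fun y s hy hs => cc_restrict_support f ξ hy s hs).continuousAt hxW
  · refine ⟨_, f.hasCompactSupport.isCompact.image QuotientGroup.continuous_mk, fun x hx => ?_⟩
    obtain ⟨s, hs⟩ : ∃ s : N, f (x * s) * starRingEnd ℂ (ξ s) ≠ 0 := by
      by_contra! h0
      exact hx (by simp [h0])
    exact ⟨x * s, subset_tsupport f (left_ne_zero_of_mul hs), by simp⟩

variable [MeasurableSpace (G ⧸ N)] (ν : Measure (G ⧸ N)) (ξ : InvariantCharacter N)

/-- The operator `T_ξ(f)(x) = ∫_N f(xs) conj(ξ(s)) dlN(s)` from `C_c(G)` to `C_ξ(G, N)`, where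
`lN` is a left Haar measure on `N`. -/
def ccTransform : C_c(G, ℂ) →ₗ[ℂ] CovariantFunction ν ξ where
  toFun f := ⟨fun x => ∫ s : N, f (x * s) * starRingEnd ℂ (ξ.toHom s) ∂lN,
    transform_mem lN f ξ.toHom⟩
  map_add' f g := Subtype.ext <| funext fun x => by
    refine Eq.trans (integral_congr_ae (.of_forall fun y => ?_))
      (integral_add (transform_integrable lN f ξ.toHom x) (transform_integrable lN g ξ.toHom x))
    exact add_mul _ _ _
  map_smul' a f := Subtype.ext <| funext fun x => by
    refine Eq.trans (integral_congr_ae (.of_forall fun y => ?_))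
      (integral_const_mul a (fun s : N => f (x * s) * starRingEnd ℂ (ξ.toHom s)))
    exact mul_assoc _ _ _

/-- Weil's formula `∫_{G/N} (∫_N f(xs) dlN(s)) dν(xN) = ∫_G f(x) dμ(x)` for `f ∈ C_c(G)`, which
normalizes the Haar measure `ν` on `G ⧸ N`. The inner integral does not depend on the
representative `x = q.out` of the coset `q`. -/
def WeilFormula (μ : Measure G) : Prop :=
  ∀ f : C_c(G, ℂ), ∫ q : G ⧸ N, (∫ s : N, f (q.out * s) ∂lN) ∂ν = ∫ x, f x ∂μ

variable [BorelSpace (G ⧸ N)] [ν.IsHaarMeasure]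

theorem norm_ccTransform_le [T2Space G] (μ : Measure G) [μ.IsHaarMeasure]
    (hW : WeilFormula lN ν μ) (f : C_c(G, ℂ)) :
    ‖ccTransform lN ν ξ f‖ ≤ ‖ccToL1 μ f‖ := by
  have hc : Continuous fun x => ((‖f x‖ : ℝ) : ℂ) :=
    Complex.continuous_ofReal.comp f.continuous_toFun.norm
  let F : C_c(G, ℂ) := ⟨⟨fun x => ((‖f x‖ : ℝ) : ℂ), hc⟩, HasCompactSupport.intro
    f.hasCompactSupport fun x hx => by simp [image_eq_zero_of_notMem_tsupport hx]⟩
  let ξ₁ : InvariantCharacter N := ⟨1, fun _ _ => rfl⟩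
  have hF : ∀ x, ccTransform lN ν ξ₁ F x = ((∫ s : N, ‖f (x * s)‖ ∂lN : ℝ) : ℂ) := fun x => by
    rw [← integral_complex_ofReal]
    refine integral_congr_ae (.of_forall fun s => ?_)
    change ((‖f (x * s)‖ : ℝ) : ℂ) * starRingEnd ℂ ((1 : Circle) : ℂ) = _
    simp
  have hF' : ∀ x, ‖ccTransform lN ν ξ₁ F x‖ = ∫ s : N, ‖f (x * s)‖ ∂lN := fun x => by
    rw [hF, Complex.norm_real, Real.norm_of_nonneg (integral_nonneg fun s => norm_nonneg _)]
  calc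
    _ ≤ ∫ q, ‖ccTransform lN ν ξ₁ F q.out‖ ∂ν := by
      refine integral_mono (CovariantFunction.integrable ν ξ _)
        (CovariantFunction.integrable ν ξ₁ _) fun q => ?_
      dsimp only
      rw [hF']
      refine (norm_integral_le_integral_norm _).trans_eq (integral_congr_ae (.of_forall fun s => ?_))
      dsimp only
      rw [norm_mul, RCLike.norm_conj, Circle.norm_coe, mul_one]
    _ = ∫ x, ‖f x‖ ∂μ := by
      simp only [hF']
      have := hW F
      have h1 : ∀ q : G ⧸ N, ∫ s : N, F (q.out * s) ∂lN =
          ((∫ s : N, ‖f (q.out * s)‖ ∂lN : ℝ) : ℂ) := fun q => integral_complex_ofReal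
      have h2 : ∫ x, F x ∂μ = ((∫ x, ‖f x‖ ∂μ : ℝ) : ℂ) := integral_complex_ofReal
      rw [h2] at this
      simp only [h1] at this
      rw [integral_complex_ofReal] at this
      exact_mod_cast this
    _ = _ := (norm_ccToL1 μ f).symm

/-- The operator `T_ξ : L¹(G) → L¹_ξ(G, N)`: the continuous extension of
`T_ξ : C_c(G) → C_ξ(G, N)`. -/
def covTransform (μ : Measure G) [μ.IsHaarMeasure] : Lp ℂ 1 μ →L[ℂ] CovariantL1 ν ξ :=
  (covToL1 ν ξ ∘ₗ ccTransform lN ν ξ).extendOfNorm (ccToL1 μ)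

theorem covTransform_ccToL1 [T2Space G] (μ : Measure G) [μ.IsHaarMeasure] [μ.Regular]
    (hW : WeilFormula lN ν μ) (f : C_c(G, ℂ)) :
    covTransform lN ν ξ μ (ccToL1 μ f) = covToL1 ν ξ (ccTransform lN ν ξ f) :=
  LinearMap.extendOfNorm_eq (denseRange_ccToL1 μ) ⟨1, fun g => by
    rw [one_mul, LinearMap.comp_apply, norm_covToL1]
    exact norm_ccTransform_le lN ν ξ μ hW g⟩ f

end Transform

/-- A two-sided approximate identity of a Banach algebra `A`: a net `e` in `A`, indexed by a
directed set, with `a * e i → a` and `e i * a → a` for every `a : A`. -/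
structure IsTwoSidedApproximateIdentity {A Λ : Type*} [NonUnitalNormedRing A] [Preorder Λ]
    [IsDirectedOrder Λ] [Nonempty Λ] (e : Λ → A) : Prop where
  right : ∀ a : A, Tendsto (fun i => a * e i) atTop (𝓝 a)
  left : ∀ a : A, Tendsto (fun i => e i * a) atTop (𝓝 a)

end CovariantAlgebra

end

/-! The map `T_ξ` is a contractive algebra homomorphism with dense range, and such a map carries an
approximate identity of norm at most `1` to an approximate identity: the limits hold on the range by
continuity and multiplicativity, and boundedness extends them to its closure
(`IsTwoSidedApproximateIdentity.map`).

In `L¹(G)` the net consists of mollifiers: nonnegative functions in `C_c(G)` of integral `1`,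
invariant under `x ↦ x⁻¹`, with supports shrinking to `1`. Convolving `g ∈ C_c(G)` with one of them
averages translates of `g` by elements close to `1`; these are uniformly close to `g` and live on a
common compact set, hence are close in `L¹` (`isTwoSidedApproximateIdentity_mollifier`). The
symmetry lets right convolution be treated like left convolution, with no modular function.

Two facts about `T_ξ` remain. It is multiplicative on `C_c(G)` by Fubini and Weil's formula, since
the integral over a coset of `f(y) T_ξ(g)(y⁻¹x)` is `T_ξ(f)(y) T_ξ(g)(y⁻¹x)` (`ccTransform_conv`).
It maps `C_c(G)` onto `C_ξ(G, N)`, because a covariant function can be cut off by a function in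
`C_c(G)` and divided by the coset integrals of the cut-off (`ccTransform_surjective`). Contractivity
is `norm_ccTransform_le`.

The net is indexed by the neighbourhoods of `1`, or by a countable base of them when `G` is second
countable. -/

noncomputable section

namespace CovariantAlgebra

/-! ### Approximate identities: reduction to a dense set and transport along homomorphisms. -/

section ApproximateIdentities

variable {A B Λ : Type*} [NonUnitalNormedRing A] [NonUnitalNormedRing B] [Preorder Λ]
  [IsDirectedOrder Λ] [Nonempty Λ]

/-- A family bounded by `1` that acts as a two-sided approximate identity on a dense set is a
two-sided approximate identity. -/
theorem isTwoSidedApproximateIdentity_of_dense {S : Set A} (hS : Dense S) {e : Λ → A}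
    (he : ∀ i, ‖e i‖ ≤ 1) (hr : ∀ a ∈ S, Tendsto (fun i => a * e i) atTop (𝓝 a))
    (hl : ∀ a ∈ S, Tendsto (fun i => e i * a) atTop (𝓝 a)) :
    IsTwoSidedApproximateIdentity e := by
  have approx : ∀ a : A, ∀ ε > 0, ∃ b ∈ S, ‖a - b‖ < ε := fun a ε hε => by
    obtain ⟨b, hb, h⟩ := Metric.mem_closure_iff.mp (hS a) ε hε
    exact ⟨b, hb, by rwa [← dist_eq_norm]⟩
  constructor <;> intro a <;> rw [Metric.tendsto_nhds] <;> intro ε hε <;>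
    obtain ⟨b, hb, hab⟩ := approx a (ε / 3) (by positivity)
  · filter_upwards [Metric.tendsto_nhds.mp (hr b hb) (ε / 3) (by positivity)] with i hi
    rw [dist_eq_norm] at hi ⊢
    -- Each of the three terms has norm below `ε / 3`; the first because `‖e i‖ ≤ 1`.
    have h1 : a * e i - a = (a - b) * e i + (b * e i - b) - (a - b) := by
      rw [sub_mul]; abel
    have h2 : ‖(a - b) * e i‖ ≤ ‖a - b‖ := (norm_mul_le _ _).trans
      (mul_le_of_le_one_right (norm_nonneg _) (he i))
    rw [h1]
    linarith [norm_sub_le ((a - b) * e i + (b * e i - b)) (a - b),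
      norm_add_le ((a - b) * e i) (b * e i - b)]
  · filter_upwards [Metric.tendsto_nhds.mp (hl b hb) (ε / 3) (by positivity)] with i hi
    rw [dist_eq_norm] at hi ⊢
    have h1 : e i * a - a = e i * (a - b) + (e i * b - b) - (a - b) := by
      rw [mul_sub]; abel
    have h2 : ‖e i * (a - b)‖ ≤ ‖a - b‖ := (norm_mul_le _ _).trans
      (mul_le_of_le_one_left (norm_nonneg _) (he i))
    rw [h1]
    linarith [norm_sub_le (e i * (a - b) + (e i * b - b)) (a - b),
      norm_add_le (e i * (a - b)) (e i * b - b)]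

/-- A continuous multiplicative map with dense range preserves two-sided approximate identities
whose image is bounded by `1`. -/
theorem IsTwoSidedApproximateIdentity.map {e : Λ → A} (he : IsTwoSidedApproximateIdentity e)
    {T : A → B} (hT : Continuous T) (hd : DenseRange T) (hm : ∀ a b, T (a * b) = T a * T b)
    (hb : ∀ i, ‖T (e i)‖ ≤ 1) : IsTwoSidedApproximateIdentity fun i => T (e i) := by
  refine isTwoSidedApproximateIdentity_of_dense hd hb ?_ ?_ <;> rintro _ ⟨a, rfl⟩
  · simpa only [← hm, Function.comp_def] using (hT.tendsto a).comp (he.right a)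
  · simpa only [← hm, Function.comp_def] using (hT.tendsto a).comp (he.left a)

end ApproximateIdentities

/-! ### Mollifiers on `G` and the approximate identity of `L¹(G)`. -/

section Mollifiers

open scoped Pointwise

variable {G : Type*} [Group G] [TopologicalSpace G] [IsTopologicalGroup G] [T2Space G]
  [MeasurableSpace G] [BorelSpace G] (μ : Measure G) [μ.IsHaarMeasure]

/-- A symmetric function of integral and `L¹`-norm `1` in `C_c(G)`, vanishing outside `U`. -/
structure IsMollifier (U : Set G) (f : C_c(G, ℂ)) : Prop where
  symm : ∀ x, f x⁻¹ = f x
  supp : ∀ x, f x ≠ 0 → x ∈ U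
  integral : ∫ x, f x ∂μ = 1
  norm : ∫ x, ‖f x‖ ∂μ = 1

/-- A Urysohn bump `h` at `1` is symmetrized additively to `h x + h x⁻¹` and divided by its
integral. -/
theorem exists_isMollifier [LocallyCompactSpace G] {U : Set G} (hU : U ∈ 𝓝 1) :
    ∃ f, IsMollifier μ U f := by
  -- The bump must live in `U ∩ U⁻¹` so that its reflection `x ↦ h x⁻¹` also vanishes outside `U`.
  have hV : U ∩ U⁻¹ ∈ 𝓝 (1 : G) := inter_mem hU (inv_mem_nhds_one G hU)
  obtain ⟨h, h1, h0, hs, hI⟩ := exists_continuous_one_zero_of_isCompact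
    (isCompact_singleton (x := (1 : G))) (isOpen_interior (s := U ∩ U⁻¹)).isClosed_compl
    (Set.disjoint_compl_right_iff_subset.mpr
      (Set.singleton_subset_iff.mpr (mem_interior_iff_mem_nhds.mpr hV)))
  have hsupp : ∀ x, h x ≠ 0 → x ∈ U ∩ U⁻¹ := fun x hx => by
    by_contra hn
    exact hx (h0 (fun hx' => hn (interior_subset hx')))
  have hgc : Continuous fun x => h x + h x⁻¹ := by fun_prop
  have hgs : HasCompactSupport fun x => h x + h x⁻¹ :=
    hs.add (hs.comp_homeomorph (Homeomorph.inv G))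
  have hg0 : 0 ≤ fun x => h x + h x⁻¹ := fun x => add_nonneg (hI x).1 (hI _).1
  have hpos : 0 < ∫ x, (h x + h x⁻¹) ∂μ :=
    hgc.integral_pos_of_hasCompactSupport_nonneg_nonzero hgs hg0 (x := 1) (by
      have : h 1 = 1 := h1 rfl
      simp [this])
  set I := ∫ x, (h x + h x⁻¹) ∂μ with hIdef
  have hf : Continuous fun x => ((I⁻¹ * (h x + h x⁻¹) : ℝ) : ℂ) := by fun_prop
  refine ⟨⟨⟨_, hf⟩, HasCompactSupport.intro hgs fun x hx => ?_⟩, ?_, ?_, ?_, ?_⟩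
  · have : h x + h x⁻¹ = 0 :=
      image_eq_zero_of_notMem_tsupport (f := fun x => h x + h x⁻¹) hx
    simp only [this, mul_zero, Complex.ofReal_zero]
  · intro x
    change ((I⁻¹ * (h x⁻¹ + h x⁻¹⁻¹) : ℝ) : ℂ) = ((I⁻¹ * (h x + h x⁻¹) : ℝ) : ℂ)
    rw [inv_inv, add_comm]
  · intro x hx
    change ((I⁻¹ * (h x + h x⁻¹) : ℝ) : ℂ) ≠ 0 at hx
    by_cases hx1 : h x = 0
    · by_cases hx2 : h x⁻¹ = 0
      · simp [hx1, hx2] at hx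
      · simpa using (hsupp _ hx2).2
    · exact (hsupp _ hx1).1
  · change ∫ x, ((I⁻¹ * (h x + h x⁻¹) : ℝ) : ℂ) ∂μ = 1
    rw [integral_complex_ofReal, integral_const_mul, ← hIdef, inv_mul_cancel₀ hpos.ne']
    simp
  · change ∫ x, ‖((I⁻¹ * (h x + h x⁻¹) : ℝ) : ℂ)‖ ∂μ = 1
    have : ∀ x, ‖((I⁻¹ * (h x + h x⁻¹) : ℝ) : ℂ)‖ = I⁻¹ * (h x + h x⁻¹) := fun x => by
      rw [Complex.norm_real, Real.norm_of_nonneg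
        (mul_nonneg (inv_nonneg.mpr hpos.le) (hg0 x))]
    simp only [this]
    rw [integral_const_mul, ← hIdef, inv_mul_cancel₀ hpos.ne']

variable {μ}

theorem IsMollifier.norm_integral_mul_le {U : Set G} {f : C_c(G, ℂ)} (hf : IsMollifier μ U f)
    {F : G → ℂ} {ε : ℝ} (hF : ∀ y ∈ U, ‖F y‖ ≤ ε) : ‖∫ y, f y * F y ∂μ‖ ≤ ε := by
  have hi : Integrable (fun y => ‖f y‖) μ :=
    (f.continuous_toFun.integrable_of_hasCompactSupport f.hasCompactSupport).norm
  refine (norm_integral_le_of_norm_le (hi.mul_const ε) (.of_forall fun y => ?_)).trans_eq ?_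
  · rw [norm_mul]
    by_cases h0 : f y = 0
    · simp [h0]
    · gcongr
      exact hF y (hf.supp y h0)
  · rw [integral_mul_const, hf.norm, one_mul]

/-- Averaging against a mollifier with small support a continuous family of functions with support
in a fixed compact set, whose member at `1` vanishes, gives a function of small `L¹`-norm. -/
theorem eventually_norm_mollified_le {h : G × G → ℂ} (hc : Continuous h) (h1 : ∀ x, h (1, x) = 0)
    {V K : Set G} (hV : V ∈ 𝓝 1) (hK : IsCompact K) (h0 : ∀ y ∈ V, ∀ x ∉ K, h (y, x) = 0)
    {ε : ℝ} (hε : 0 < ε) :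
    ∀ᶠ U in (𝓝 (1 : G)).smallSets, ∀ f, IsMollifier μ U f → ∀ p : C_c(G, ℂ),
      (∀ x, p x = ∫ y, f y * h (y, x) ∂μ) → ‖ccToL1 μ p‖ < ε := by
  -- The function `p` will be bounded by `δ` on `K` and vanish elsewhere, so its norm is at most
  -- `μ(K) δ`. Adding `1` keeps the denominator positive and makes the final inequality strict.
  set δ := ε / (μ.real K + 1) with hδ
  have hK0 : 0 ≤ μ.real K := measureReal_nonneg
  have hδ0 : 0 < δ := by positivity
  -- Tube lemma: `h` vanishes on `{1} × K`, so compactness of `K` gives one neighbourhood of `1`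
  -- that serves all `x ∈ K`.
  have hev : ∀ᶠ y in 𝓝 (1 : G), ∀ x ∈ K, ‖h (y, x)‖ < δ :=
    hK.eventually_forall_of_forall_eventually fun x _ =>
      hc.norm.continuousAt.eventually_lt_const (by simpa [h1] using hδ0)
  refine eventually_smallSets.mpr ⟨_, inter_mem hV hev, fun U hU f hf p hp => ?_⟩
  have hp0 : ∀ x ∉ K, p x = 0 := fun x hx => by
    rw [hp x, ← integral_zero G ℂ (μ := μ)]
    congr 1
    funext y
    by_cases hy : f y = 0
    · simp [hy]
    · simp [h0 y (hU (hf.supp y hy)).1 x hx]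
  have hpb : ∀ x, ‖p x‖ ≤ K.indicator (fun _ => δ) x := fun x => by
    by_cases hx : x ∈ K
    · rw [Set.indicator_of_mem hx, hp x]
      exact hf.norm_integral_mul_le fun y hy => ((hU hy).2 x hx).le
    · simp [hp0 x hx, hx]
  have hi : Integrable (K.indicator fun _ => δ) μ :=
    (integrable_indicator_iff hK.measurableSet).mpr
      (integrableOn_const hK.measure_lt_top.ne)
  rw [norm_ccToL1]
  calc _ ≤ ∫ x, K.indicator (fun _ => δ) x ∂μ :=
        integral_mono (p.continuous_toFun.integrable_of_hasCompactSupport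
          p.hasCompactSupport).norm hi hpb
    _ = μ.real K * δ := by
        rw [integral_indicator_const _ hK.measurableSet, smul_eq_mul]
    _ < ε := by
        rw [hδ, ← mul_div_assoc, div_lt_iff₀ (by positivity)]
        nlinarith

/-- As `f` has integral `1`, the value `g x` is itself an average against `f`. This puts the error
in the form required by `eventually_norm_mollified_le`. -/
theorem IsMollifier.ccConv_left_sub {U : Set G} {f : C_c(G, ℂ)} (hf : IsMollifier μ U f)
    (g : C_c(G, ℂ)) (x : G) :
    (ccConv μ f g - g) x = ∫ y, f y * (g (y⁻¹ * x) - g x) ∂μ := by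
  have hi : Integrable f μ :=
    f.continuous_toFun.integrable_of_hasCompactSupport f.hasCompactSupport
  simp only [mul_sub]
  rw [integral_sub (cc_integrable_conv μ f g x) (hi.mul_const _), integral_mul_const, hf.integral,
    one_mul]
  rfl

/-- The substitution `y ↦ x * y`, allowed by left invariance, turns the second factor into `f y⁻¹`,
which is `f y` by symmetry. No right invariance of `μ` is needed. -/
theorem IsMollifier.ccConv_right_sub {U : Set G} {f : C_c(G, ℂ)} (hf : IsMollifier μ U f)
    (g : C_c(G, ℂ)) (x : G) :
    (ccConv μ g f - g) x = ∫ y, f y * (g (x * y) - g x) ∂μ := by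
  have hi : Integrable f μ :=
    f.continuous_toFun.integrable_of_hasCompactSupport f.hasCompactSupport
  have h1 : ∀ y, g (x * y) * f ((x * y)⁻¹ * x) = f y * g (x * y) := fun y => by
    rw [mul_inv_rev, mul_assoc, inv_mul_cancel, mul_one, hf.symm, mul_comm]
  have h2 : Integrable (fun y => f y * g (x * y)) μ := by
    simpa only [h1] using (cc_integrable_conv μ g f x).comp_mul_left x
  simp only [mul_sub]
  rw [integral_sub h2 (hi.mul_const _), integral_mul_const, hf.integral, one_mul]
  change (∫ y, g y * f (y⁻¹ * x) ∂μ) - g x = _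
  rw [← integral_mul_left_eq_self (fun y => g y * f (y⁻¹ * x)) x]
  simp only [h1]

variable [LocallyCompactSpace G] [μ.Regular]

/-- Mollifiers whose supports shrink to `1` form a two-sided approximate identity of `L¹(G)`. -/
theorem isTwoSidedApproximateIdentity_mollifier {Λ : Type*} [Preorder Λ] [IsDirectedOrder Λ]
    [Nonempty Λ] {U : Λ → Set G} (hU : Tendsto U atTop (𝓝 1).smallSets) {f : Λ → C_c(G, ℂ)}
    (hf : ∀ i, IsMollifier μ (U i) (f i)) :
    IsTwoSidedApproximateIdentity fun i => ccToL1 μ (f i) := by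
  obtain ⟨V, hVc, hV⟩ := exists_compact_mem_nhds (1 : G)
  refine isTwoSidedApproximateIdentity_of_dense (denseRange_ccToL1 μ) (fun i => ?_) ?_ ?_
  · rw [norm_ccToL1, (hf i).norm]
  · rintro _ ⟨g, rfl⟩
    rw [Metric.tendsto_nhds]
    intro ε hε
    have hg := g.continuous_toFun
    have := eventually_norm_mollified_le (μ := μ) (h := fun z => g (z.2 * z.1) - g z.2)
      ((hg.comp (by fun_prop)).sub (hg.comp (by fun_prop))) (by simp) hV
      -- For `y ∈ V`, the translate `x ↦ g (x * y)` is supported in `supp g * V⁻¹`; the subtracted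
      -- `g` accounts for the second set.
      ((g.hasCompactSupport.isCompact.mul hVc.inv).union g.hasCompactSupport.isCompact)
      (fun y hy x hx => by
        rw [image_eq_zero_of_notMem_tsupport (x := x) fun h => hx (Or.inr h),
          image_eq_zero_of_notMem_tsupport (x := x * y) fun h => hx
            (Or.inl ⟨x * y, h, y⁻¹, by simpa using hy, by simp⟩), sub_zero]) hε
    filter_upwards [hU.eventually this] with i hi
    rw [dist_eq_norm, ccToL1_mul, ← map_sub]
    exact hi (f i) (hf i) _ ((hf i).ccConv_right_sub g)
  · rintro _ ⟨g, rfl⟩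
    rw [Metric.tendsto_nhds]
    intro ε hε
    have hg := g.continuous_toFun
    have := eventually_norm_mollified_le (μ := μ) (h := fun z => g (z.1⁻¹ * z.2) - g z.2)
      ((hg.comp (by fun_prop)).sub (hg.comp (by fun_prop))) (by simp) hV
      ((hVc.mul g.hasCompactSupport.isCompact).union g.hasCompactSupport.isCompact)
      (fun y hy x hx => by
        rw [image_eq_zero_of_notMem_tsupport (x := x) fun h => hx (Or.inr h),
          image_eq_zero_of_notMem_tsupport (x := y⁻¹ * x) fun h => hx
            (Or.inl ⟨y, hy, y⁻¹ * x, h, by simp⟩), sub_zero]) hε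
    filter_upwards [hU.eventually this] with i hi
    rw [dist_eq_norm, ccToL1_mul, ← map_sub]
    exact hi (f i) (hf i) _ ((hf i).ccConv_left_sub g)

end Mollifiers

/-! ### `T_ξ` as an algebra homomorphism with dense range. -/

section TransformHomomorphism

variable {G : Type*} [Group G] [TopologicalSpace G] [IsTopologicalGroup G]
  [LocallyCompactSpace G] [MeasurableSpace G] [BorelSpace G] {N : Subgroup G} [N.Normal]
  [IsClosed (N : Set G)]

/-- Openness makes the image of a compact neighbourhood a neighbourhood, and finitely many of these
cover `K`. This supplies a compact subset of `G` meeting every coset in `q(supp ψ)`, although `supp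
ψ` itself need not be compact. -/
theorem IsOpenQuotientMap.exists_isCompact_subset_image {X Y : Type*} [TopologicalSpace X]
    [TopologicalSpace Y] [WeaklyLocallyCompactSpace X] {p : X → Y} (hp : IsOpenQuotientMap p)
    {K : Set Y} (hK : IsCompact K) : ∃ L : Set X, IsCompact L ∧ K ⊆ p '' L := by
  refine hK.induction_on (p := fun K => ∃ L : Set X, IsCompact L ∧ K ⊆ p '' L)
    ⟨∅, isCompact_empty, by simp⟩ ?_ ?_ ?_
  · rintro s t hst ⟨L, hL, h⟩
    exact ⟨L, hL, hst.trans h⟩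
  · rintro s t ⟨L, hL, h⟩ ⟨M, hM, h'⟩
    exact ⟨L ∪ M, hL.union hM, by rw [Set.image_union]; exact Set.union_subset_union h h'⟩
  · intro y _
    obtain ⟨x, rfl⟩ := hp.surjective y
    obtain ⟨L, hL, hx⟩ := exists_compact_mem_nhds x
    exact ⟨p '' L, mem_nhdsWithin_of_mem_nhds (hp.isOpenMap.image_mem_nhds hx), L, hL,
      subset_rfl⟩

variable (lN : Measure N) [lN.IsHaarMeasure]

/-- The values lie on the circle, where inversion is conjugation. This is how the conjugate
character of `T_ξ` arises from the covariance of `T_ξ(g)` at `(y s)⁻¹ x`. -/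
theorem extChar_coe_inv (χ : N →ₜ* Circle) (s : N) :
    extChar χ (s : G)⁻¹ = starRingEnd ℂ (χ s) := by
  rw [extChar_of_mem _ _ (inv_mem s.2), ← Circle.coe_inv_eq_conj, ← map_inv]
  rfl

/-- For a compact subset `K` of `G ⧸ N` there is a function in `C_c(G)` whose integrals over the
cosets in `K` are positive. -/
theorem exists_cc_integral_coset_pos {K : Set (G ⧸ N)} (hK : IsCompact K) :
    ∃ (h : C_c(G, ℂ)) (H : G → ℝ), Continuous H ∧ (∀ x, (H x : ℂ) = ∫ s : N, h (x * s) ∂lN) ∧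
      (∀ x (k : N), H (x * k) = H x) ∧ ∀ x : G, (x : G ⧸ N) ∈ K → 0 < H x := by
  obtain ⟨L, hL, hKL⟩ := IsOpenQuotientMap.exists_isCompact_subset_image
    (QuotientGroup.isOpenQuotientMap_mk (N := N)) hK
  obtain ⟨h, h1, -, hs, hI⟩ := exists_continuous_one_zero_of_isCompact hL isClosed_empty
    (Set.disjoint_empty L)
  have hc : Continuous fun x => ((h x : ℝ) : ℂ) := by fun_prop
  let f : C_c(G, ℂ) := ⟨⟨_, hc⟩, HasCompactSupport.intro hs fun x hx => by
    simp [image_eq_zero_of_notMem_tsupport hx]⟩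
  have hf : ∀ x, f x = ((h x : ℝ) : ℂ) := fun _ => rfl
  -- The coset integral is the transform for the trivial character, so its continuity is part of
  -- `transform_mem`.
  have hT : ∀ x, ((∫ s : N, h (x * s) ∂lN : ℝ) : ℂ) =
      ∫ s : N, f (x * s) * starRingEnd ℂ ((1 : N →ₜ* Circle) s) ∂lN := fun x => by
    rw [← integral_complex_ofReal]
    refine integral_congr_ae (.of_forall fun s => ?_)
    change _ = f (x * s) * starRingEnd ℂ ((1 : Circle) : ℂ)
    simp [hf]
  refine ⟨f, fun x => ∫ s : N, h (x * s) ∂lN, ?_, fun x => ?_, fun x k => ?_, fun x hx => ?_⟩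
  · refine (Complex.continuous_re.comp (transform_mem lN f 1).1).congr fun x => ?_
    rw [Function.comp_apply, ← hT, Complex.ofReal_re]
  · simp only [hf, integral_complex_ofReal]
  · beta_reduce
    rw [← integral_mul_left_eq_self (fun s : N => h (x * s)) k]
    simp [mul_assoc]
  -- The coset of `x` contains a point `y` of `L`, where `h = 1`; a nonnegative continuous function
  -- that is nonzero somewhere has positive Haar integral.
  · obtain ⟨y, hy, hyx⟩ := hKL hx
    have hn : x⁻¹ * y ∈ N := QuotientGroup.eq.mp hyx.symm
    have hcs : Continuous fun s : N => h (x * s) := by fun_prop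
    refine hcs.integral_pos_of_hasCompactSupport_nonneg_nonzero (x := ⟨x⁻¹ * y, hn⟩)
      (HasCompactSupport.intro (cc_restrict_compact f (isCompact_singleton (x := x)))
        fun s hs => ?_) (fun s => (hI _).1) ?_
    · by_contra h0
      refine hs ⟨x, rfl, x * s, subset_tsupport f ?_, by simp⟩
      simpa [hf] using h0
    · simp [h1 hy]

variable [MeasurableSpace (G ⧸ N)] (ν : Measure (G ⧸ N)) (ξ : InvariantCharacter N)

theorem ccTransform_apply (f : C_c(G, ℂ)) (x : G) :
    ccTransform lN ν ξ f x = ∫ s : N, f (x * s) * starRingEnd ℂ (ξ.toHom s) ∂lN := rfl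

/-- The map `T_ξ : C_c(G) → C_ξ(G, N)` is surjective. -/
theorem ccTransform_surjective : Function.Surjective (ccTransform lN ν ξ) := by
  intro ψ
  obtain ⟨h, H, hHc, hH, hHk, hpos⟩ := exists_cc_integral_coset_pos lN ψ.2.2.1
  have hpos' : ∀ x ∈ tsupport ψ.1, (H x : ℂ) ≠ 0 := fun x hx =>
    Complex.ofReal_ne_zero.mpr (hpos x ⟨x, hx, rfl⟩).ne'
  have hc : Continuous fun x => ψ x / H x := by
    rw [continuous_iff_continuousAt]
    intro x
    by_cases hx : x ∈ tsupport ψ.1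
    · exact ψ.2.1.continuousAt.div (Complex.continuous_ofReal.comp hHc).continuousAt (hpos' x hx)
    -- Off the support `H` may vanish, but the numerator is zero on a whole neighbourhood, so the
    -- quotient is locally `0`.
    · refine continuousAt_const.congr (f := fun _ => (0 : ℂ)) ?_
      filter_upwards [(isClosed_tsupport ψ.1).isOpen_compl.mem_nhds hx] with y hy
      simp [image_eq_zero_of_notMem_tsupport hy]
  -- With `H` constant on cosets and `ψ (x s) conj(ξ s) = ψ x`, the factor `ψ / H` leaves the
  -- integral over `N`, and the remaining integral of `h` is `H`.
  let f : C_c(G, ℂ) := ⟨⟨fun x => h x * (ψ x / H x), h.continuous_toFun.mul hc⟩,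
    HasCompactSupport.intro h.hasCompactSupport fun x hx => by
      simp [image_eq_zero_of_notMem_tsupport hx]⟩
  refine ⟨f, Subtype.ext (funext fun x => ?_)⟩
  have h1 : ∀ s : N, f (x * s) * starRingEnd ℂ (ξ.toHom s) = h (x * s) * (ψ x / H x) :=
    fun s => by
    change h (x * s) * (ψ (x * s) / H (x * s)) * _ = _
    have h2 : (ξ.toHom s : ℂ) * starRingEnd ℂ (ξ.toHom s) = 1 := by
      rw [Complex.mul_conj, Circle.normSq_coe, Complex.ofReal_one]
    rw [hHk, ψ.2.2.2 x s]
    linear_combination h (x * s) * (ψ x / H x) * h2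
  rw [ccTransform_apply]
  simp only [h1]
  rw [integral_mul_const, ← hH]
  by_cases hx : x ∈ tsupport ψ.1
  · exact mul_div_cancel₀ _ (hpos' x hx)
  · have : ψ x = 0 := image_eq_zero_of_notMem_tsupport hx
    rw [this]
    simp

variable [T2Space G] [BorelSpace (G ⧸ N)] [ν.IsHaarMeasure] {ν} {lN} {μ : Measure G}
  [μ.IsHaarMeasure]

/-- The map `T_ξ : C_c(G) → C_ξ(G, N)` is multiplicative. -/
theorem ccTransform_conv (hW : WeilFormula lN ν μ) (f g : C_c(G, ℂ)) :
    ccTransform lN ν ξ (ccConv μ f g) =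
      covConv ν ξ (ccTransform lN ν ξ f) (ccTransform lN ν ξ g) := by
  refine Subtype.ext (funext fun x => ?_)
  have hf := f.continuous_toFun
  have hg := g.continuous_toFun
  have hTg := (ccTransform lN ν ξ g).2.1
  -- `F` is the function to which Weil's formula is applied. Its integral over `G` is `T_ξ(f ∗
  -- g)(x)`, and its coset integrals form the integrand of the covariant convolution.
  let F : C_c(G, ℂ) := ⟨⟨fun y => f y * ccTransform lN ν ξ g (y⁻¹ * x),
    hf.mul (hTg.comp (by fun_prop))⟩, HasCompactSupport.intro f.hasCompactSupport fun y hy => by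
      simp [image_eq_zero_of_notMem_tsupport hy]⟩
  have hF : ∀ (y : G) (s : N), F (y * s) =
      f (y * s) * starRingEnd ℂ (ξ.toHom s) * ccTransform lN ν ξ g (y⁻¹ * x) := fun y s => by
    change f (y * s) * ccTransform lN ν ξ g ((y * s)⁻¹ * x) = _
    rw [(ccTransform lN ν ξ g).good.inv_right x y s (by simp), extChar_coe_inv, mul_assoc]
  have hconj : Continuous fun s : N => starRingEnd ℂ (ξ.toHom s : ℂ) :=
    Complex.continuous_conj.comp (continuous_subtype_val.comp ξ.toHom.continuous_toFun)
  calc ∫ s : N, (∫ y, f y * g (y⁻¹ * (x * s)) ∂μ) * starRingEnd ℂ (ξ.toHom s) ∂lN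
      = ∫ s : N, (∫ y, f y * (g (y⁻¹ * x * s) * starRingEnd ℂ (ξ.toHom s)) ∂μ) ∂lN := by
        simp only [← integral_mul_const, mul_assoc]
    _ = ∫ y, (∫ s : N, f y * (g (y⁻¹ * x * s) * starRingEnd ℂ (ξ.toHom s)) ∂lN) ∂μ := by
        -- This form of Fubini needs no σ-finiteness, only a continuous integrand with compact
        -- support: `y` stays in `supp f`, and `s` in the compact set of those `s ∈ N` that carry
        -- some point of `(supp f)⁻¹ x` into `supp g`.
        refine integral_integral_swap_of_hasCompactSupport
          (f := fun (s : N) y => f y * (g (y⁻¹ * x * s) * starRingEnd ℂ (ξ.toHom s))) ?_ ?_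
        · exact (hf.comp continuous_snd).mul
            ((hg.comp (by fun_prop)).mul (hconj.comp continuous_fst))
        · have hWc : IsCompact ((fun y => y⁻¹ * x) '' tsupport f) :=
            f.hasCompactSupport.isCompact.image (by fun_prop)
          refine HasCompactSupport.intro
            ((cc_restrict_compact g hWc).prod f.hasCompactSupport.isCompact) ?_
          rintro ⟨s, y⟩ hsy
          by_contra h0
          have hy : y ∈ tsupport f := subset_tsupport f (left_ne_zero_of_mul h0)
          have h2 := left_ne_zero_of_mul (right_ne_zero_of_mul h0)
          exact hsy ⟨⟨_, ⟨y, hy, rfl⟩, y⁻¹ * x * s, subset_tsupport g h2, by group⟩, hy⟩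
    _ = ∫ y, F y ∂μ := by
        simp only [integral_const_mul]
        rfl
    _ = ∫ q : G ⧸ N, (∫ s : N, F (q.out * s) ∂lN) ∂ν := (hW F).symm
    _ = ∫ q : G ⧸ N, ccTransform lN ν ξ f q.out * ccTransform lN ν ξ g (q.out⁻¹ * x) ∂ν := by
        simp only [hF, integral_mul_const, ccTransform_apply]

variable [μ.Regular]

/-- The operator `T_ξ : L¹(G) → L¹_ξ(G, N)` is multiplicative. -/
theorem covTransform_mul (hW : WeilFormula lN ν μ) (a b : Lp ℂ 1 μ) :
    covTransform lN ν ξ μ (a * b) = covTransform lN ν ξ μ a * covTransform lN ν ξ μ b := by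
  refine (denseRange_ccToL1 μ).induction_on₂ (p := fun a b => covTransform lN ν ξ μ (a * b) =
    covTransform lN ν ξ μ a * covTransform lN ν ξ μ b) ?_ (fun f g => ?_) a b
  · exact isClosed_eq (by fun_prop) (by fun_prop)
  · rw [ccToL1_mul, covTransform_ccToL1 lN ν ξ μ hW, covTransform_ccToL1 lN ν ξ μ hW,
      covTransform_ccToL1 lN ν ξ μ hW, covToL1_mul, ccTransform_conv ξ hW]

/-- The operator `T_ξ : L¹(G) → L¹_ξ(G, N)` has dense range. -/
theorem denseRange_covTransform (hW : WeilFormula lN ν μ) :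
    DenseRange (covTransform lN ν ξ μ) := by
  refine (denseRange_covToL1 ν ξ).mono ?_
  rintro _ ⟨ψ, rfl⟩
  obtain ⟨f, rfl⟩ := ccTransform_surjective lN ν ξ ψ
  exact ⟨ccToL1 μ f, covTransform_ccToL1 lN ν ξ μ hW f⟩

/-- The images under `T_ξ` of mollifiers whose supports shrink to `1` form a two-sided approximate
identity of `L¹_ξ(G, N)`. -/
theorem isTwoSidedApproximateIdentity_covTransform_mollifier (hW : WeilFormula lN ν μ)
    {Λ : Type*} [Preorder Λ] [IsDirectedOrder Λ] [Nonempty Λ] {U : Λ → Set G}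
    (hU : Tendsto U atTop (𝓝 1).smallSets) {f : Λ → C_c(G, ℂ)}
    (hf : ∀ i, IsMollifier μ (U i) (f i)) :
    IsTwoSidedApproximateIdentity fun i => covTransform lN ν ξ μ (ccToL1 μ (f i)) := by
  refine (isTwoSidedApproximateIdentity_mollifier hU hf).map (covTransform lN ν ξ μ).continuous
    (denseRange_covTransform ξ hW) (covTransform_mul ξ hW) fun i => ?_
  rw [covTransform_ccToL1 lN ν ξ μ hW, norm_covToL1]
  exact (norm_ccTransform_le lN ν ξ μ hW _).trans_eq ((norm_ccToL1 μ _).trans (hf i).norm)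

end TransformHomomorphism

end CovariantAlgebra

end

theorem mainTheorem4 {G : Type u} [Group G] [TopologicalSpace G] [IsTopologicalGroup G]
    [LocallyCompactSpace G] [T2Space G] [MeasurableSpace G] [BorelSpace G]
    (N : Subgroup G) [N.Normal] [IsClosed (N : Set G)]
    [MeasurableSpace (G ⧸ N)] [BorelSpace (G ⧸ N)]
    (μ : Measure G) [μ.IsHaarMeasure] [μ.Regular]
    (lN : Measure N) [lN.IsHaarMeasure]
    (ν : Measure (G ⧸ N)) [ν.IsHaarMeasure]
    (hW : CovariantAlgebra.WeilFormula lN ν μ)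
    (ξ : CovariantAlgebra.InvariantCharacter N) :
    (∃ (Λ : Type u) (_ : Preorder Λ) (_ : IsDirectedOrder Λ) (_ : Nonempty Λ)
        (f : Λ → Lp ℂ 1 μ),
      CovariantAlgebra.IsTwoSidedApproximateIdentity f ∧
      CovariantAlgebra.IsTwoSidedApproximateIdentity
        (fun α => CovariantAlgebra.covTransform lN ν ξ μ (f α))) ∧
    (SecondCountableTopology G →
      ∃ f : ℕ → Lp ℂ 1 μ,
        CovariantAlgebra.IsTwoSidedApproximateIdentity f ∧
        CovariantAlgebra.IsTwoSidedApproximateIdentity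
          (fun n => CovariantAlgebra.covTransform lN ν ξ μ (f n))) := by
  refine ⟨?_, fun _ => ?_⟩
  -- The index set is the set of all neighbourhoods of `1` under reverse inclusion, directed by
  -- intersection.
  · choose f hf using fun U : {U : Set G // U ∈ 𝓝 1}ᵒᵈ =>
      CovariantAlgebra.exists_isMollifier μ (OrderDual.ofDual U).2
    have hdir : IsDirectedOrder {U : Set G // U ∈ 𝓝 1}ᵒᵈ :=
      ⟨fun U V => ⟨OrderDual.toDual ⟨_, inter_mem (OrderDual.ofDual U).2 (OrderDual.ofDual V).2⟩,
        fun _ h => h.1,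
        fun _ h => h.2⟩⟩
    have hne : Nonempty {U : Set G // U ∈ 𝓝 1}ᵒᵈ := ⟨OrderDual.toDual ⟨Set.univ, univ_mem⟩⟩
    have hU : Tendsto (fun U : {U : Set G // U ∈ 𝓝 1}ᵒᵈ => (OrderDual.ofDual U).1) atTop
        (𝓝 1).smallSets :=
      tendsto_smallSets_iff.mpr fun t ht => eventually_atTop.mpr
        ⟨OrderDual.toDual ⟨t, ht⟩, fun V hV => hV⟩
    exact ⟨_, inferInstance, hdir, hne, _,
      CovariantAlgebra.isTwoSidedApproximateIdentity_mollifier hU hf,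
      CovariantAlgebra.isTwoSidedApproximateIdentity_covTransform_mollifier ξ hW hU hf⟩
  -- Of second countability, only the countable neighbourhood base at `1` is used.
  · obtain ⟨U, hU⟩ := (𝓝 (1 : G)).exists_antitone_basis
    choose f hf using fun n => CovariantAlgebra.exists_isMollifier μ (hU.mem n)
    exact ⟨_, CovariantAlgebra.isTwoSidedApproximateIdentity_mollifier hU.tendsto_smallSets hf,
      CovariantAlgebra.isTwoSidedApproximateIdentity_covTransform_mollifier ξ hW
        hU.tendsto_smallSets hf⟩
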